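/- **Setting.** Let $\mu$ be the fair-coin (Lebesgue) measure on $2^\omega$; identify subsets of $\omega$ with elements of $2^\omega$, and let $(x\oplus y)(2n)=x(n)$, $(x\oplus y)(2n+1)=y(n)$. For $g,f\in\omega^\omega$ write $g\le^* f$ if $g(n)\le f(n)$ for all but finitely many $n$. A function $f\in\omega^\omega$ is *uniformly almost everywhere dominating* if $$\mu\{Z\in 2^\omega : (\forall g\in\omega^\omega)\,[\,g\le_T Z\Rightarrow g\le^* f\,]\}=1,$$ and *uniformly almost everywhere dominating over $B\subseteq\omega$* if the same holds with $g\le_T B\oplus Z$ in place of $g\le_T Z$. Let $\Psi_0,\Psi_1,\dots$ be an effective list of all Turing functionals $2^\omega\to\omega^\omega$, and let $\Phi$ be the universal partial computable functional with $\Phi(B\oplus 0^i1Y)=\Psi_i(B\oplus Y)$ whenever the right-hand side is total, equipped with stages such that $\Phi(X;n)\!\downarrow[s]$ implies $\Phi(X;n)[s]\le s$ and $\Phi(X;m)\!\downarrow[s]$ for all $m<n$. For $B\subseteq\omega$ let $\operatorname{dom}_B\Phi=\{Z\in 2^\omega:\Phi(B\oplus Z)\text{ is total}\}$, and for $n\in\omega$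 and $g\in\omega^{<\omega}$ let $$D^B_{[n,|g|)}[g]=\{Z\in 2^\omega: \Phi(B\oplus Z;k)\!\downarrow[g(k)]\text{ for all } n\le k<|g|\}.$$ The notion of forcing $\mathbb P_B$ consists of the conditions $\langle f,\epsilon\rangle$ with $f\in\omega^{<\omega}$ and $\epsilon$ a positive rational. A condition $\langle g,\delta\rangle$ extends $\langle f,\epsilon\rangle$ if $f\subseteq g$, $\delta\le\epsilon$ and, if $f\ne g$, $$\mu\bigl(\operatorname{dom}_B\Phi\smallsetminus D^B_{[|f|,|g|)}[g]\bigr)+\delta<\epsilon .$$ This is a partial order. Write $\mathbb P=\mathbb P_\emptyset$, and for a filter $G\subset\mathbb P_B$ let $f^G=\bigcup\{f:\langle f,\epsilon\rangle\in G\}$. A statement holds for all *sufficiently generic* $G\subset\mathbb P_B$ if there is a countable family of dense subsets of $\mathbb P_B$ such that the statement holds for every filter $G\subset\mathbb P_B$ that meets each member of the family. **Theorem.** 1. If $G\subset\mathbb P$ is sufficiently generic, then $f^G\in\omega^\omega$ and $f^G$ is uniformly almost everywhere dominating. 2. For every $B\subseteq\omega$: if $G\subset\mathbb P_B$ is sufficiently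 generic (the family of dense sets depending only on $B$), then $f^G\in\omega^\omega$ and $f^G$ is uniformly almost everywhere dominating over $B$. 3. For all $A,B\subseteq\omega$ with $A\not\le_T B$: if $G\subset\mathbb P_B$ is sufficiently generic over $A$ (the family of dense sets may depend on $A$ and $B$), then $f^G\in\omega^\omega$ and $A\not\le_T B\oplus f^G$. -/

import Mathlib

open MeasureTheory Filter

namespace AEDom

/-- Cantor space `2^ω`; its points are identified with subsets of `ω`. -/
abbrev Cantor : Type := ℕ → Bool

/-- Lebesgue (fair-coin) measure on `2^ω`. -/
noncomputable def coinMeasure : Measure Cantor :=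
  Measure.infinitePi fun _ : ℕ => (PMF.uniformOfFintype Bool).toMeasure

instance : IsProbabilityMeasure coinMeasure := by
  unfold coinMeasure; infer_instance

/-- The join `x ⊕ y`: `(x ⊕ y)(2n) = x n` and `(x ⊕ y)(2n+1) = y n`. -/
def join {α : Type} (x y : ℕ → α) : ℕ → α :=
  fun n => if n % 2 = 0 then x (n / 2) else y (n / 2)

/-- The characteristic function of a set, with values `0`, `1`. -/
def char (X : Cantor) : ℕ → ℕ := fun n => (X n).toNat

/-- Turing reducibility `g ≤_T h` between total functions. -/
def Reducible (g h : ℕ → ℕ) : Prop :=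
  TuringReducible (g : ℕ →. ℕ) (h : ℕ →. ℕ)

/-- `g ≤* f`: `f` dominates `g`. -/
def Dominated (g f : ℕ → ℕ) : Prop := ∀ᶠ n in atTop, g n ≤ f n

/-- `f` is uniformly almost everywhere dominating. -/
def UniformlyAEDominating (f : ℕ → ℕ) : Prop :=
  ∀ᵐ Z ∂coinMeasure, ∀ g : ℕ → ℕ, Reducible g (char Z) → Dominated g f

/-- `f` is uniformly almost everywhere dominating over `B`. -/
def UniformlyAEDominatingOver (B : Cantor) (f : ℕ → ℕ) : Prop :=
  ∀ᵐ Z ∂coinMeasure, ∀ g : ℕ → ℕ, Reducible g (char (join B Z)) → Dominated g f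

/-- An effective list `Ψ_0, Ψ_1, …` of all Turing functionals `2^ω → ω^ω`, with stages:
`Psi i X n s` is `Ψ_i(X; n)[s]`. The `i`-th partial recursive function `φ_i` is run on
pairs (finite initial segment of the oracle, input). All pairs (length `k`, number of steps `u`)
are tried in the order of their codes `t`, and the first answer found is the output;
at stage `s`, the codes `t ≤ s` have been tried. -/
def Psi (i : ℕ) (X : Cantor) (n s : ℕ) : Option ℕ :=
  (List.range (s + 1)).findSome? fun t =>
    Nat.Partrec.Code.evaln t.unpair.2 (Denumerable.ofNat Nat.Partrec.Code i)
      (Encodable.encode ((List.range t.unpair.1).map X, n))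

/-- The universal functional before normalization: on the oracle `B ⊕ 0^i 1 Y` it simulates
`Ψ_i(B ⊕ Y)`. (It diverges on `B ⊕ 0^∞`.) -/
def rawPhi (X : Cantor) (n s : ℕ) : Option ℕ :=
  ((List.range (s + 1)).find? fun i => X (2 * i + 1)).bind fun i =>
    Psi i (join (fun j => X (2 * j)) (fun j => X (2 * (i + 1 + j) + 1))) n s

/-- The universal functional `Φ`, with stages: `Phi X n s` is `Φ(X; n)[s]`. It is normalized so
that `Φ(X; n)↓[s]` implies `Φ(X; n)[s] ≤ s` and `Φ(X; m)↓[s]` for all `m < n`. -/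
def Phi (X : Cantor) (n s : ℕ) : Option ℕ :=
  if (List.range (n + 1)).all fun m => (rawPhi X m s).any fun v => decide (v ≤ s) then
    rawPhi X n s
  else none

/-- `dom Φ` relative to `B`: the set of all `Z` such that `Φ(B ⊕ Z)` is total. -/
def domPhi (B : Cantor) : Set Cantor :=
  {Z | ∀ n, ∃ s, (Phi (join B Z) n s).isSome}

/-- `D_{[n,|g|)}[g]` relative to `B`: the set of all `Z` such that
`Φ(B ⊕ Z; k)↓[g(k)]` for all `k` with `n ≤ k < |g|`. -/
def boundedBy (B : Cantor) (n : ℕ) (g : List ℕ) : Set Cantor :=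
  {Z | ∀ k, ∀ hk : k < g.length, n ≤ k → (Phi (join B Z) k g[k]).isSome}

/-- A forcing condition `⟨f, ε⟩` of `ℙ_B`. -/
@[ext]
structure Condition (B : Cantor) where
  stem : List ℕ
  eps : ℚ
  eps_pos : 0 < eps

/-- `q` extends `p`. -/
def Condition.Extends {B : Cantor} (q p : Condition B) : Prop :=
  p.stem <+: q.stem ∧ q.eps ≤ p.eps ∧
    (p.stem ≠ q.stem →
      coinMeasure.real (domPhi B \ boundedBy B p.stem.length q.stem) + (q.eps : ℝ) < (p.eps : ℝ))

theorem Condition.Extends.trans {B : Cantor} {r q p : Condition B}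
    (h₁ : r.Extends q) (h₂ : q.Extends p) : r.Extends p := by
  obtain ⟨a₁, b₁, c₁⟩ := h₁
  obtain ⟨a₂, b₂, c₂⟩ := h₂
  refine ⟨a₂.trans a₁, b₁.trans b₂, fun hne => ?_⟩
  by_cases e₁ : q.stem = r.stem
  · have h := c₂ (e₁ ▸ hne)
    rw [e₁] at h
    have : (r.eps : ℝ) ≤ q.eps := by exact_mod_cast b₁
    linarith
  by_cases e₂ : p.stem = q.stem
  · have h := c₁ e₁
    rw [← e₂] at h
    have : (q.eps : ℝ) ≤ p.eps := by exact_mod_cast b₂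
    linarith
  have h₁ := c₁ e₁
  have h₂ := c₂ e₂
  have hsub : domPhi B \ boundedBy B p.stem.length r.stem ⊆
      (domPhi B \ boundedBy B p.stem.length q.stem) ∪
        (domPhi B \ boundedBy B q.stem.length r.stem) := by
    rintro Z ⟨hZ, hZ'⟩
    by_contra hcon
    simp only [Set.mem_union, Set.mem_sdiff, not_or, not_and, not_not] at hcon
    obtain ⟨u, v⟩ := hcon
    refine hZ' fun k hk hn => ?_
    by_cases hkq : k < q.stem.length
    · have := u hZ k hkq hn
      rwa [a₁.getElem hkq] at this
    · exact v hZ k hk (not_lt.mp hkq)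
  have hm := (measureReal_mono hsub (measure_ne_top coinMeasure _)).trans
    (measureReal_union_le (μ := coinMeasure) _ _)
  linarith

/-- The partial order `ℙ_B`; `q ≤ p` means that `q` extends `p`. -/
instance (B : Cantor) : PartialOrder (Condition B) where
  le q p := q.Extends p
  le_refl p := ⟨List.prefix_refl _, le_refl _, fun h => absurd rfl h⟩
  le_trans _ _ _ h₁ h₂ := Condition.Extends.trans h₁ h₂
  le_antisymm _ _ h₁ h₂ :=
    Condition.ext (h₂.1.eq_of_length (le_antisymm h₂.1.length_le h₁.1.length_le))
      (le_antisymm h₁.2.1 h₂.2.1)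

/-- `D` is dense in a notion of forcing. -/
def ForcingDense {P : Type} [Preorder P] (D : Set P) : Prop := ∀ p, ∃ q ∈ D, q ≤ p

/-- `Q` holds of every sufficiently generic filter: for some countable family of dense sets,
`Q` holds of all filters that meet every member of the family. -/
def ForSufficientlyGeneric {P : Type} [Preorder P] (Q : Order.PFilter P → Prop) : Prop :=
  ∃ 𝒟 : Set (Set P), 𝒟.Countable ∧ (∀ D ∈ 𝒟, ForcingDense D) ∧
    ∀ G : Order.PFilter P, (∀ D ∈ 𝒟, ∃ p ∈ D, p ∈ G) → Q G

/-- The union `f^G` of the strings of the conditions in `G` is the total function `f`. -/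
def IsGenericFunction {B : Cantor} (G : Order.PFilter (Condition B)) (f : ℕ → ℕ) : Prop :=
  ∀ n m, f n = m ↔ ∃ p ∈ G, p.stem[n]? = some m

end AEDom

/-!
A condition `⟨f, ε⟩` promises that the values added to `f` later bound the convergence stages of
`Φ(B ⊕ Z)` for all `Z ∈ dom_B Φ` outside a set of measure less than `ε`. Along a generic filter `ε`
tends to `0`, so for almost every `Z ∈ dom_B Φ` the stage `f^G k` is eventually large enough for
`Φ(B ⊕ Z; k)` to converge, and by the normalization of `Φ` it then bounds the value. Each functional
`Ψ_i` is handled by this single statement because almost every `Z` has the property that `0^i 1 Z`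
avoids a given null set.

For cone avoidance, let `Γ` be a functional and `⟨f, ε⟩` a condition no extension of which forces
`Γ(B ⊕ f^G)` to be wrong or divergent somewhere. Whether a string `g` may extend `f` depends on the
measure of a subset of `dom_B Φ`, which `B` cannot compute. However, `dom_B Φ` is approximated up to
a fraction of `ε` by the clopen set of those `Z` with `Φ(B ⊕ Z; n)↓[s]` for suitable fixed `n` and
`s`, and with this set in its place the measure is a fraction found by counting finite strings. So
`B` can search for an admissible `g` on which `Γ` converges, and the answers are correct: `A ≤_T B`.
-/

namespace AEDom

/-! ### Primitive recursion -/

section Primrec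

variable {α : Type*} [Primcodable α]

theorem primrecPred_exists_lt {R : ℕ → α → Prop} {b : α → ℕ} (hR : PrimrecRel R)
    (hb : Primrec b) : PrimrecPred fun a => ∃ m < b a, R m a :=
  (hR.exists_mem_list.comp (Primrec.list_range.comp hb) Primrec.id).of_eq fun a => by simp

theorem primrecPred_forall_lt {R : ℕ → α → Prop} {b : α → ℕ} (hR : PrimrecRel R)
    (hb : Primrec b) : PrimrecPred fun a => ∀ m < b a, R m a :=
  (hR.forall_mem_list.comp (Primrec.list_range.comp hb) Primrec.id).of_eq fun a => by simp

theorem primrec_findSome? {β σ : Type*} [Primcodable β] [Primcodable σ] {l : α → List β}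
    {f : α → β → Option σ} (hl : Primrec l) (hf : Primrec₂ f) :
    Primrec fun a => (l a).findSome? (f a) :=
  (Primrec.list_head?.comp (Primrec.listFilterMap hl hf)).of_eq fun _ => List.head?_filterMap ..

theorem primrec_find? {β : Type*} [Primcodable β] {l : α → List β} {p : α → β → Bool}
    (hl : Primrec l) (hp : Primrec₂ p) : Primrec fun a => (l a).find? (p a) :=
  (Primrec.list_getElem?.comp hl (Primrec.list_findIdx hl hp)).of_eq fun _ =>
    List.find?_eq_getElem?_findIdx.symm

theorem primrec_two_pow : Primrec fun m : ℕ => 2 ^ m :=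
  (Primrec₂.unpaired'.1 Nat.Primrec.pow).comp (Primrec.const 2) Primrec.id

theorem primrec_testBit : Primrec₂ Nat.testBit :=
  (Primrec.eq.comp (Primrec.nat_mod.comp (Primrec.nat_div.comp Primrec.fst
    (primrec_two_pow.comp Primrec.snd)) (Primrec.const 2)) (Primrec.const 1)).decide.of_eq
    fun _ => Nat.testBit_eq_decide_div_mod_eq.symm

theorem primrec_count {R : ℕ → α → Prop} [DecidableRel R] {b : α → ℕ} (hR : PrimrecRel R)
    (hb : Primrec b) : Primrec fun a => Nat.count (fun m => R m a) (b a) :=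
  (Primrec.list_length.comp (hR.listFilter.comp (Primrec.list_range.comp hb) Primrec.id)).of_eq
    fun _ => List.countP_eq_length_filter.symm

theorem primrec_list_sum : Primrec (List.sum : List ℕ → ℕ) :=
  Primrec.list_foldr Primrec.id (Primrec.const 0)
    (Primrec.nat_add.comp (Primrec.fst.comp Primrec.snd) (Primrec.snd.comp Primrec.snd)).to₂

end Primrec

/-! ### Turing functionals -/

/-- The initial segment of length `k` of `h`, as a string. -/
def initSeg {α : Type*} (h : ℕ → α) (k : ℕ) : List α := (List.range k).map h

@[simp]
theorem length_initSeg {α : Type*} (h : ℕ → α) (k : ℕ) : (initSeg h k).length = k := by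
  simp [initSeg]

theorem initSeg_prefix_initSeg {α : Type*} (h : ℕ → α) {k l : ℕ} (hkl : k ≤ l) :
    initSeg h k <+: initSeg h l := by
  obtain ⟨d, rfl⟩ := Nat.exists_eq_add_of_le hkl
  simp [initSeg, List.range_add]

theorem getElem?_initSeg {α : Type*} (h : ℕ → α) {k n : ℕ} (hn : n < k) :
    (initSeg h k)[n]? = some (h n) := by
  simp [initSeg, hn]

theorem getD_initSeg {α : Type*} (h : ℕ → α) (d : α) {k n : ℕ} (hn : n < k) :
    (initSeg h k).getD n d = h n := by
  simp [initSeg, hn]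

theorem initSeg_congr {α : Type*} {g h : ℕ → α} {k : ℕ} (hgh : ∀ n < k, g n = h n) :
    initSeg g k = initSeg h k :=
  List.map_congr_left fun n hn => hgh n (List.mem_range.1 hn)

/-- A Turing functional, given by its action on finite parts of the oracle: `Γ σ n` is the value
computed on input `n` when only the finite oracle `σ` may be queried. -/
structure TuringFunctional where
  toFun : List ℕ → ℕ →. ℕ
  partrec : Partrec₂ toFun
  mono : ∀ ⦃σ τ : List ℕ⦄, σ <+: τ → ∀ n, toFun σ n ≤ toFun τ n

namespace TuringFunctional

instance : CoeFun TuringFunctional fun _ => List ℕ → ℕ →. ℕ := ⟨toFun⟩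

theorem toFun_injective : Function.Injective toFun := fun ⟨_, _, _⟩ ⟨_, _, _⟩ h => by
  cases h; rfl

theorem exists_code (Γ : TuringFunctional) : ∃ c : Nat.Partrec.Code,
    ∀ σ n, c.eval (Encodable.encode (σ, n)) = Γ σ n := by
  obtain ⟨c, hc⟩ := Nat.Partrec.Code.exists_code.1 Γ.partrec
  exact ⟨c, fun σ n => by
    simp only [hc, Encodable.encodek, Part.coe_some, Part.bind_some]
    exact Part.map_id' (fun _ => rfl) _⟩

instance : Countable TuringFunctional := by
  choose c hc using exists_code
  refine Function.Injective.countable (f := c) fun Γ Δ h => toFun_injective ?_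
  funext σ n
  rw [← hc Γ, ← hc Δ, h]

/-- `Γ.Computes h f` says that the partial function computed by `Γ` from the oracle `h` extends
the partial function `f`; for total `f` the two are equal. -/
def Computes (Γ : TuringFunctional) (h : ℕ → ℕ) (f : ℕ →. ℕ) : Prop :=
  ∀ n, ∀ v ∈ f n, ∀ᶠ k in atTop, v ∈ Γ (initSeg h k) n

variable {Γ Δ : TuringFunctional} {h : ℕ → ℕ} {f g : ℕ →. ℕ}

theorem Computes.eq_of_mem {g : ℕ → ℕ} (hg : Γ.Computes h g) {n k v : ℕ}
    (hv : v ∈ Γ (initSeg h k) n) : v = g n := by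
  obtain ⟨l, hl, hkl⟩ := ((hg n (g n) (Part.mem_some _)).and (eventually_ge_atTop k)).exists
  exact Part.mem_unique (Γ.mono (initSeg_prefix_initSeg h hkl) n v hv) hl

/-- The functional that computes `f` without querying its oracle. -/
def ofPartrec (f : ℕ →. ℕ) (hf : Nat.Partrec f) : TuringFunctional where
  toFun _ n := f n
  partrec := (Partrec.nat_iff.2 hf).comp Computable.snd
  mono _ _ _ _ := le_rfl

theorem computes_ofPartrec (hf : Nat.Partrec f) : (ofPartrec f hf).Computes h f :=
  fun _ _ hv => Eventually.of_forall fun _ => hv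

/-- The functional that returns its oracle. -/
def oracle : TuringFunctional where
  toFun σ n := (σ[n]? : Option ℕ)
  partrec :=
    Computable.ofOption (f := fun p : List ℕ × ℕ => p.1[p.2]?) Primrec.list_getElem?.to_comp
  mono σ τ hστ n v hv := by
    obtain ⟨ρ, rfl⟩ := hστ
    obtain ⟨hn, rfl⟩ := List.getElem?_eq_some_iff.1 (Part.mem_coe.1 hv)
    exact Part.mem_coe.2 (List.getElem?_eq_some_iff.2
      ⟨hn.trans_le (List.prefix_append σ ρ).length_le, List.getElem_append_left hn⟩)

theorem computes_oracle : oracle.Computes h h := fun n v hv => by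
  obtain rfl := Part.mem_some_iff.1 hv
  filter_upwards [eventually_gt_atTop n] with k hk
  exact Part.mem_coe.2 (getElem?_initSeg h hk)

/-- The functional that pairs the values of `Γ` and `Δ`. -/
def pair (Γ Δ : TuringFunctional) : TuringFunctional where
  toFun σ n := (Γ σ n).bind fun a => (Δ σ n).map (Nat.pair a)
  partrec := Γ.partrec.bind <| .map
    (Δ.partrec.comp (Computable.fst.comp Computable.fst) (Computable.snd.comp Computable.fst))
    (Primrec₂.natPair.to_comp.comp (Computable.snd.comp Computable.fst) Computable.snd)
  mono σ τ hστ n v hv := by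
    simp only [Part.mem_bind_iff, Part.mem_map_iff] at hv ⊢
    obtain ⟨a, ha, b, hb, rfl⟩ := hv
    exact ⟨a, Γ.mono hστ n a ha, b, Δ.mono hστ n b hb, rfl⟩

theorem Computes.pair (hf : Γ.Computes h f) (hg : Δ.Computes h g) :
    (Γ.pair Δ).Computes h fun n => Nat.pair <$> f n <*> g n := fun n v hv => by
  simp only [Seq.seq, Part.map_eq_map, Part.mem_bind_iff, Part.mem_map_iff] at hv
  obtain ⟨_, ⟨a, ha, rfl⟩, b, hb, rfl⟩ := hv
  filter_upwards [hf n a ha, hg n b hb] with k ha hb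
  exact Part.mem_bind_iff.2 ⟨a, ha, Part.mem_map _ hb⟩

/-- The composition of the functionals `Γ` and `Δ` with a common oracle. -/
def comp (Γ Δ : TuringFunctional) : TuringFunctional where
  toFun σ n := (Δ σ n).bind (Γ σ)
  partrec := Δ.partrec.bind (Γ.partrec.comp (Computable.fst.comp Computable.fst) Computable.snd)
  mono σ τ hστ n v hv := by
    obtain ⟨a, ha, hv⟩ := Part.mem_bind_iff.1 hv
    exact Part.mem_bind_iff.2 ⟨a, Δ.mono hστ n a ha, Γ.mono hστ a v hv⟩

theorem Computes.comp (hf : Γ.Computes h f) (hg : Δ.Computes h g) :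
    (Γ.comp Δ).Computes h fun n => g n >>= f := fun n v hv => by
  obtain ⟨a, ha, hv⟩ := Part.mem_bind_iff.1 hv
  filter_upwards [hg n a ha, hf a v hv] with k ha hv
  exact Part.mem_bind_iff.2 ⟨a, ha, hv⟩

/-- The primitive recursion with base case `Γ` and recursion step `Δ`. -/
def prec (Γ Δ : TuringFunctional) : TuringFunctional where
  toFun σ p := Nat.rec (motive := fun _ => Part ℕ) (Γ σ p.unpair.1)
    (fun y IH => IH.bind fun i => Δ σ (Nat.pair p.unpair.1 (Nat.pair y i))) p.unpair.2
  partrec := by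
    have parameter : Computable fun q : List ℕ × ℕ => q.2.unpair.1 :=
      Computable.fst.comp (Computable.unpair.comp Computable.snd)
    have stepInput : Computable₂ fun (q : List ℕ × ℕ) (z : ℕ × ℕ) =>
        Nat.pair q.2.unpair.1 (Nat.pair z.1 z.2) :=
      Primrec₂.natPair.to_comp.comp (parameter.comp Computable.fst)
        (Primrec₂.natPair.to_comp.comp (Computable.fst.comp Computable.snd)
          (Computable.snd.comp Computable.snd))
    exact Partrec.nat_rec (Computable.snd.comp (Computable.unpair.comp Computable.snd))
      (Γ.partrec.comp Computable.fst parameter)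
      (Δ.partrec.comp (Computable.fst.comp Computable.fst) stepInput).to₂
  mono σ τ hστ p := by
    induction p.unpair.2 with
    | zero => exact Γ.mono hστ _
    | succ y ih =>
      intro v hv
      obtain ⟨i, hi, hv⟩ := Part.mem_bind_iff.1 hv
      exact Part.mem_bind_iff.2 ⟨i, ih i hi, Δ.mono hστ _ v hv⟩

theorem Computes.prec (hf : Γ.Computes h f) (hg : Δ.Computes h g) :
    (Γ.prec Δ).Computes h fun p =>
      Nat.rec (motive := fun _ => Part ℕ) (f p.unpair.1)
        (fun y IH => IH.bind fun i => g (Nat.pair p.unpair.1 (Nat.pair y i))) p.unpair.2 := by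
  intro p
  dsimp only [TuringFunctional.prec]
  induction p.unpair.2 with
  | zero => exact hf _
  | succ y ih =>
    intro v hv
    obtain ⟨i, hi, hv⟩ := Part.mem_bind_iff.1 hv
    filter_upwards [ih i hi, hg _ v hv] with k hi hv
    exact Part.mem_bind_iff.2 ⟨i, hi, hv⟩

theorem mem_rfind_eq_zero {F : ℕ → Part ℕ} {v : ℕ} :
    v ∈ Nat.rfind (fun n => (fun m => decide (m = 0)) <$> F n) ↔
      0 ∈ F v ∧ ∀ w < v, ∃ m ∈ F w, m ≠ 0 := by
  refine Nat.mem_rfind.trans ?_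
  simp only [Part.map_eq_map, Part.mem_map_iff, decide_eq_true_eq, decide_eq_false_iff_not,
    exists_eq_right]

/-- The unbounded search for a zero of `Γ`. -/
def rfind (Γ : TuringFunctional) : TuringFunctional where
  toFun σ a := Nat.rfind fun n => (fun m => decide (m = 0)) <$> Γ σ (Nat.pair a n)
  partrec := .rfind <| .map
    (Γ.partrec.comp (Computable.fst.comp Computable.fst)
      (Primrec₂.natPair.to_comp.comp (Computable.snd.comp Computable.fst) Computable.snd))
    (Computable.comp (f := fun m : ℕ => decide (m = 0))
      (Primrec.eq.comp Primrec.id (Primrec.const 0)).decide.to_comp Computable.snd)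
  mono σ τ hστ a v hv := by
    obtain ⟨hv, hlt⟩ := mem_rfind_eq_zero.1 hv
    exact mem_rfind_eq_zero.2 ⟨Γ.mono hστ _ 0 hv, fun w hw =>
      (hlt w hw).imp fun m hm => ⟨Γ.mono hστ _ m hm.1, hm.2⟩⟩

theorem Computes.rfind (hf : Γ.Computes h f) :
    Γ.rfind.Computes h fun a =>
      Nat.rfind fun n => (fun m => decide (m = 0)) <$> f (Nat.pair a n) := fun a v hv => by
  obtain ⟨hv, hlt⟩ := mem_rfind_eq_zero.1 hv
  have hlt : ∀ᶠ k in atTop, ∀ w ∈ Set.Iio v, ∃ m ∈ Γ (initSeg h k) (Nat.pair a w), m ≠ 0 := by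
    refine (eventually_all_finite (Set.finite_Iio v)).2 fun w hw => ?_
    obtain ⟨m, hm, hm0⟩ := hlt w hw
    exact (hf _ m hm).mono fun k hk => ⟨m, hk, hm0⟩
  filter_upwards [hf _ 0 hv, hlt] with k hv hlt using mem_rfind_eq_zero.2 ⟨hv, hlt⟩

theorem exists_computes_of_recursiveIn (hf : Nat.RecursiveIn {(h : ℕ →. ℕ)} f) :
    ∃ Γ : TuringFunctional, Γ.Computes h f := by
  induction hf with
  | zero => exact ⟨_, computes_ofPartrec .zero⟩
  | succ => exact ⟨_, computes_ofPartrec .succ⟩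
  | left => exact ⟨_, computes_ofPartrec .left⟩
  | right => exact ⟨_, computes_ofPartrec .right⟩
  | oracle g hg => obtain rfl : g = h := hg; exact ⟨_, computes_oracle⟩
  | pair _ _ ihf ihg => obtain ⟨⟨_, hf⟩, _, hg⟩ := And.intro ihf ihg; exact ⟨_, hf.pair hg⟩
  | comp _ _ ihf ihg => obtain ⟨⟨_, hf⟩, _, hg⟩ := And.intro ihf ihg; exact ⟨_, hf.comp hg⟩
  | prec _ _ ihf ihg => obtain ⟨⟨_, hf⟩, _, hg⟩ := And.intro ihf ihg; exact ⟨_, hf.prec hg⟩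
  | rfind _ ihf => obtain ⟨_, hf⟩ := ihf; exact ⟨_, hf.rfind⟩

end TuringFunctional

theorem Reducible.exists_computes {g h : ℕ → ℕ} (hgh : Reducible g h) :
    ∃ Γ : TuringFunctional, Γ.Computes h g :=
  TuringFunctional.exists_computes_of_recursiveIn (RecursiveIn.iff_nat.1 hgh)

/-! ### Reductions by search -/

section RecursiveIn

variable {O : Set (ℕ →. ℕ)}

theorem recursiveIn_of_primrec {f : ℕ → ℕ} (hf : Primrec f) : Nat.RecursiveIn O f :=
  (Primrec.nat_iff.1 hf).recursiveIn

theorem recursiveIn_comp {f g : ℕ → ℕ} (hf : Nat.RecursiveIn O f) (hg : Nat.RecursiveIn O g) :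
    Nat.RecursiveIn O (fun n => f (g n) : ℕ → ℕ) :=
  (hf.comp hg).of_eq fun n => Part.bind_some (g n) (f : ℕ →. ℕ)

theorem recursiveIn_pair {f g : ℕ → ℕ} (hf : Nat.RecursiveIn O f) (hg : Nat.RecursiveIn O g) :
    Nat.RecursiveIn O (fun n => Nat.pair (f n) (g n) : ℕ → ℕ) :=
  (hf.pair hg).of_eq fun n => by simp [Seq.seq]

theorem recursiveIn_initSeg {h : ℕ → ℕ} (hh : Nat.RecursiveIn O h) :
    Nat.RecursiveIn O (fun k => Encodable.encode (initSeg h k) : ℕ → ℕ) := by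
  have concat : Primrec fun p : ℕ => Encodable.encode
      ((Encodable.decode (α := List ℕ) p.unpair.2).getD [] ++ [p.unpair.1]) :=
    Primrec.encode.comp <| Primrec.list_concat.comp
      (Primrec.option_getD.comp (Primrec.decode.comp (Primrec.snd.comp Primrec.unpair))
        (Primrec.const []))
      (Primrec.fst.comp Primrec.unpair)
  have state : Primrec fun p : ℕ => p.unpair.2.unpair :=
    Primrec.unpair.comp (Primrec.snd.comp Primrec.unpair)
  have step : Nat.RecursiveIn O _ := recursiveIn_comp (recursiveIn_of_primrec concat)
    (recursiveIn_pair (recursiveIn_comp hh (recursiveIn_of_primrec (Primrec.fst.comp state)))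
      (recursiveIn_of_primrec (Primrec.snd.comp state)))
  have recursion := (Nat.RecursiveIn.prec (recursiveIn_of_primrec
    (Primrec.const (Encodable.encode ([] : List ℕ)))) step).comp
      (recursiveIn_pair (recursiveIn_of_primrec (Primrec.const 0))
        (recursiveIn_of_primrec Primrec.id))
  refine recursion.of_eq fun k => ?_
  simp only [PFun.coe_val, Part.bind_eq_bind, Part.bind_some, Nat.unpair_pair, id]
  induction k with
  | zero => rfl
  | succ k ih =>
    simp only [ih, Part.bind_some, Encodable.encodek, Option.getD_some]
    rw [initSeg, initSeg, List.range_succ, List.map_append, List.map_singleton]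

theorem recursiveIn_rfindOpt {f : ℕ → ℕ → Option ℕ}
    (hf : Nat.RecursiveIn O (fun p => Encodable.encode (f p.unpair.1 p.unpair.2) : ℕ → ℕ)) :
    Nat.RecursiveIn O fun x => Nat.rfindOpt (f x) := by
  have search := Nat.RecursiveIn.rfind <| recursiveIn_comp
    (recursiveIn_of_primrec (Primrec.nat_sub.comp (Primrec.const 1) Primrec.id)) hf
  have value := recursiveIn_comp (recursiveIn_of_primrec Primrec.pred) hf
  refine (value.comp ((recursiveIn_of_primrec Primrec.id).pair search)).of_eq fun x => ?_
  have isSome_eq : ∀ n, decide (1 - Encodable.encode (f x n) = 0) = (f x n).isSome := fun n => by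
    cases f x n <;> simp
  simp only [Seq.seq, PFun.coe_val, Part.map_eq_map, Part.map_some, Part.bind_some, id,
    Nat.unpair_pair, isSome_eq]
  ext v
  refine Part.mem_bind_iff.trans (Iff.trans ?_ Part.mem_bind_iff.symm)
  simp only [Part.mem_map_iff, PFun.coe_val, exists_exists_and_eq_and, Nat.unpair_pair,
    Part.mem_some_iff]
  refine exists_congr fun n => and_congr_right fun hn => ?_
  obtain ⟨w, hw⟩ := Option.isSome_iff_exists.1 (Part.mem_some_iff.1 (Nat.rfind_spec hn)).symm
  simp [hw]

end RecursiveIn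

theorem reducible_of_primrec_search {f h : ℕ → ℕ} {P : List ℕ × ℕ × ℕ → Option ℕ} (hP : Primrec P)
    (sound : ∀ k w x, ∀ v ∈ P (initSeg h k, w, x), v = f x)
    (complete : ∀ x, ∃ k w, (P (initSeg h k, w, x)).isSome) : Reducible f h := by
  let search (x t : ℕ) : Option ℕ := P (initSeg h t.unpair.1, t.unpair.2, x)
  have eval : Primrec fun q : ℕ => Encodable.encode
      (P ((Encodable.decode (α := List ℕ) q.unpair.1).getD [],
        q.unpair.2.unpair.2.unpair.2, q.unpair.2.unpair.1)) := by
    have input : Primrec fun q : ℕ => q.unpair.2.unpair :=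
      Primrec.unpair.comp (Primrec.snd.comp Primrec.unpair)
    exact Primrec.encode.comp <| hP.comp <| Primrec.pair
      (Primrec.option_getD.comp (Primrec.decode.comp (Primrec.fst.comp Primrec.unpair))
        (Primrec.const []))
      (Primrec.pair (Primrec.snd.comp (Primrec.unpair.comp (Primrec.snd.comp input)))
        (Primrec.fst.comp input))
  have recursiveIn_search : Nat.RecursiveIn {(h : ℕ →. ℕ)}
      (fun p => Encodable.encode (search p.unpair.1 p.unpair.2) : ℕ → ℕ) := by
    have oracle := recursiveIn_comp
      (recursiveIn_initSeg (.oracle (h : ℕ →. ℕ) (Set.mem_singleton _)))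
      (recursiveIn_of_primrec (Primrec.fst.comp (Primrec.unpair.comp
        (Primrec.snd.comp Primrec.unpair))))
    refine (recursiveIn_comp (recursiveIn_of_primrec eval)
      (recursiveIn_pair oracle (recursiveIn_of_primrec Primrec.id))).of_eq fun p => ?_
    simp [search]
  refine RecursiveIn.iff_nat.2 ((recursiveIn_rfindOpt recursiveIn_search).of_eq_tot fun x => ?_)
  obtain ⟨k, w, hkw⟩ := complete x
  have hkw : (search x (Nat.pair k w)).isSome := by
    simpa only [search, Nat.unpair_pair] using hkw
  have hdom : (Nat.rfindOpt (search x)).Dom := Nat.rfindOpt_dom.2 ⟨_, _, Option.get_mem hkw⟩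
  obtain ⟨t, ht⟩ := Nat.rfindOpt_spec (Part.get_mem hdom)
  rw [← sound _ _ _ _ ht]
  exact Part.get_mem hdom

/-! ### The universal functional -/

section Stages

theorem findSome?_congr {α β : Type*} {f g : α → Option β} {l : List α}
    (h : ∀ a ∈ l, f a = g a) : l.findSome? f = l.findSome? g := by
  rw [← List.head?_filterMap, ← List.head?_filterMap, List.filterMap_congr h]

theorem findSome?_range_mono {α : Type*} {f : ℕ → Option α} {s t : ℕ} (hst : s ≤ t) {v : α}
    (h : (List.range s).findSome? f = some v) : (List.range t).findSome? f = some v := by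
  obtain ⟨d, rfl⟩ := Nat.exists_eq_add_of_le hst
  rw [List.range_add, List.findSome?_append, h, Option.some_or]

theorem find?_range_mono {p : ℕ → Bool} {s t : ℕ} (hst : s ≤ t) {v : ℕ}
    (h : (List.range s).find? p = some v) : (List.range t).find? p = some v := by
  obtain ⟨d, rfl⟩ := Nat.exists_eq_add_of_le hst
  rw [List.range_add, List.find?_append, h, Option.some_or]

variable {X : Cantor} {i m n s t v : ℕ}

theorem Psi_mono (hst : s ≤ t) (h : Psi i X n s = some v) : Psi i X n t = some v :=
  findSome?_range_mono (Nat.succ_le_succ hst) h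

theorem rawPhi_mono (hst : s ≤ t) (h : rawPhi X n s = some v) : rawPhi X n t = some v := by
  obtain ⟨i, hi, h⟩ := Option.bind_eq_some_iff.1 h
  exact Option.bind_eq_some_iff.2
    ⟨i, find?_range_mono (Nat.succ_le_succ hst) hi, Psi_mono hst h⟩

theorem Phi_isSome_iff :
    (Phi X n s).isSome ↔ ∀ m ≤ n, ∃ v ≤ s, rawPhi X m s = some v := by
  have normalized : ((List.range (n + 1)).all fun m =>
      (rawPhi X m s).any fun v => decide (v ≤ s)) = true ↔
        ∀ m ≤ n, ∃ v ≤ s, rawPhi X m s = some v := by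
    simp only [List.all_eq_true, List.mem_range, Nat.lt_succ_iff, Option.any_eq_true,
      decide_eq_true_eq]
    exact forall₂_congr fun m _ => exists_congr fun v => and_comm
  simp only [Phi, normalized]
  split_ifs with h
  · obtain ⟨v, -, hv⟩ := h n le_rfl
    simpa only [hv, Option.isSome_some, true_iff] using h
  · simpa only [Option.isSome_none, Bool.false_eq_true, false_iff] using h

theorem Phi_isSome_mono (hmn : m ≤ n) (hst : s ≤ t) (h : (Phi X n s).isSome) :
    (Phi X m t).isSome := by
  rw [Phi_isSome_iff] at h ⊢
  intro k hk
  obtain ⟨v, hv, h⟩ := h k (hk.trans hmn)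
  exact ⟨v, hv.trans hst, rawPhi_mono hst h⟩

theorem le_of_Phi_isSome (hs : (Phi X n s).isSome) (hv : rawPhi X n t = some v) : v ≤ s := by
  obtain ⟨w, hw, h⟩ := Phi_isSome_iff.1 hs n le_rfl
  have hvw := (rawPhi_mono (le_max_left t s) hv).symm.trans (rawPhi_mono (le_max_right t s) h)
  exact Option.some_injective _ hvw ▸ hw

theorem exists_Phi_isSome (h : ∀ n, ∃ s v, rawPhi X n s = some v) (n : ℕ) :
    ∃ s, (Phi X n s).isSome := by
  choose s v hsv using h
  refine ⟨(Finset.range (n + 1)).sup fun m => max (s m) (v m), Phi_isSome_iff.2 fun m hm => ?_⟩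
  have hle := Finset.le_sup (f := fun m => max (s m) (v m)) (Finset.mem_range_succ_iff.2 hm)
  exact ⟨v m, (le_max_right _ _).trans hle, rawPhi_mono ((le_max_left _ _).trans hle) (hsv m)⟩

end Stages

theorem TuringFunctional.exists_index (Γ : TuringFunctional) : ∃ i, ∀ (X : Cantor) k n,
    (Denumerable.ofNat Nat.Partrec.Code i).eval (Encodable.encode (initSeg X k, n)) =
      Γ (initSeg (char X) k) n := by
  obtain ⟨c, hc⟩ := Γ.exists_code
  have hbits : Nat.Partrec fun a => c.eval (Encodable.encode
      (((Encodable.decode (α := List Bool × ℕ) a).getD ([], 0)).map (List.map Bool.toNat) id)) := by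
    have hmap : Primrec fun q : List Bool × ℕ => q.map (List.map Bool.toNat) id :=
      Primrec.pair (Primrec.list_map Primrec.fst
        ((Primrec.dom_finite Bool.toNat).comp Primrec.snd).to₂) Primrec.snd
    exact Partrec.nat_iff.1 <| (Partrec.nat_iff.2 (Nat.Partrec.Code.exists_code.2 ⟨c, rfl⟩)).comp
      (Primrec.encode.comp (hmap.comp
        (Primrec.option_getD.comp Primrec.decode (Primrec.const _)))).to_comp
  obtain ⟨d, hd⟩ := Nat.Partrec.Code.exists_code.1 hbits
  refine ⟨Encodable.encode d, fun X k n => ?_⟩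
  simp only [Denumerable.ofNat_encode, hd, Encodable.encodek, Option.getD_some, Prod.map_apply,
    id, hc]
  congr 1
  simp [initSeg, char, Function.comp_def]

theorem Reducible.exists_Psi {g : ℕ → ℕ} {X : Cantor} (hg : Reducible g (char X)) :
    ∃ i, ∀ n, ∃ s, Psi i X n s = some (g n) := by
  obtain ⟨Γ, hΓ⟩ := hg.exists_computes
  obtain ⟨i, hi⟩ := Γ.exists_index
  refine ⟨i, fun n => ?_⟩
  obtain ⟨k, hk⟩ := (hΓ n (g n) (Part.mem_some _)).exists
  rw [← hi] at hk
  obtain ⟨u, hu⟩ := Nat.Partrec.Code.evaln_complete.1 hk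
  have halts : (Psi i X n (Nat.pair k u)).isSome := by
    rw [Psi, List.findSome?_isSome_iff]
    refine ⟨Nat.pair k u, List.self_mem_range_succ, ?_⟩
    rw [Nat.unpair_pair]
    exact Option.isSome_iff_exists.2 ⟨g n, hu⟩
  obtain ⟨v, hv⟩ := Option.isSome_iff_exists.1 halts
  obtain ⟨t, -, ht⟩ := List.exists_of_findSome?_eq_some hv
  have hvg : v = g n := hΓ.eq_of_mem (hi X _ n ▸ Nat.Partrec.Code.evaln_sound ht)
  exact ⟨Nat.pair k u, hvg ▸ hv⟩

section Join

variable {α : Type} (x y : ℕ → α)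

theorem join_two_mul (n : ℕ) : join x y (2 * n) = x n := by
  simp [join]

theorem join_two_mul_add_one (n : ℕ) : join x y (2 * n + 1) = y n := by
  have hdiv : (2 * n + 1) / 2 = n := by omega
  simp [join, hdiv]

theorem join_congr {x x' y y' : ℕ → α} {m : ℕ} (hx : ∀ j < m, x j = x' j)
    (hy : ∀ j < m, y j = y' j) : ∀ j < 2 * m, join x y j = join x' y' j := fun j hj => by
  rw [join, join, hx _ (by omega), hy _ (by omega)]

end Join

theorem rawPhi_join {B W : Cantor} {i n s : ℕ} (h0 : ∀ j < i, W j = false) (h1 : W i = true)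
    (hs : i ≤ s) : rawPhi (join B W) n s = Psi i (join B fun j => W (i + 1 + j)) n s := by
  have find_eq : (List.range (s + 1)).find? (fun j => join B W (2 * j + 1)) = some i := by
    refine find?_range_mono (Nat.succ_le_succ hs) ?_
    rw [List.range_succ, List.find?_append, List.find?_eq_none.2]
    · simp [join_two_mul_add_one, h1]
    · intro j hj
      simp [join_two_mul_add_one, h0 j (List.mem_range.1 hj)]
  rw [rawPhi, find_eq]
  simp only [Option.bind_some, join_two_mul, join_two_mul_add_one]

theorem dependsOn_Psi (i n s : ℕ) : DependsOn (fun X : Cantor => Psi i X n s) (Set.Iio s) := by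
  intro X Y h
  refine findSome?_congr fun t ht => ?_
  have hts : t.unpair.1 ≤ s :=
    (Nat.unpair_left_le t).trans (Nat.lt_succ_iff.1 (List.mem_range.1 ht))
  change Nat.Partrec.Code.evaln _ _ (Encodable.encode (initSeg X _, n)) =
    Nat.Partrec.Code.evaln _ _ (Encodable.encode (initSeg Y _, n))
  rw [initSeg_congr fun j hj => h j (hj.trans_le hts)]

theorem dependsOn_rawPhi (n s : ℕ) :
    DependsOn (fun X : Cantor => rawPhi X n s) (Set.Iio (4 * (s + 1))) := by
  intro X Y h
  have find_eq : (List.range (s + 1)).find? (fun i => X (2 * i + 1)) =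
      (List.range (s + 1)).find? fun i => Y (2 * i + 1) :=
    List.find?_congr fun i hi => h _ <| by
      have := List.mem_range.1 hi
      simp only [Set.mem_Iio]; omega
  simp only [rawPhi, find_eq]
  refine Option.bind_congr fun i hi => dependsOn_Psi i n s fun j hj => ?_
  have his := List.mem_range.1 (List.mem_of_find?_eq_some hi)
  refine join_congr (m := s) ?_ ?_ j (by simp only [Set.mem_Iio] at hj; omega)
  all_goals exact fun k hk => h _ (by simp only [Set.mem_Iio]; omega)

theorem dependsOn_Phi (n s : ℕ) :
    DependsOn (fun X : Cantor => Phi X n s) (Set.Iio (4 * (s + 1))) := by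
  intro X Y h
  simp only [Phi, dependsOn_rawPhi _ s h]

section Primrec

variable {α : Type*} [Primcodable α]

theorem primrec_join {σ : Type} [Primcodable σ] {X Y : α → ℕ → σ} (hX : Primrec₂ X)
    (hY : Primrec₂ Y) : Primrec₂ fun a => join (X a) (Y a) :=
  have half : Primrec fun p : α × ℕ => p.2 / 2 :=
    Primrec.nat_div.comp Primrec.snd (Primrec.const 2)
  Primrec.ite (Primrec.eq.comp (Primrec.nat_mod.comp Primrec.snd (Primrec.const 2))
    (Primrec.const 0)) (hX.comp Primrec.fst half) (hY.comp Primrec.fst half)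

variable {i n s : α → ℕ} {X : α → Cantor}

theorem primrec_initSeg {β : Type*} [Primcodable β] {f : α → ℕ → β} (hf : Primrec₂ f)
    (hn : Primrec n) : Primrec fun a => initSeg (f a) (n a) :=
  Primrec.list_map (Primrec.list_range.comp hn) hf

theorem primrec_Psi (hi : Primrec i) (hX : Primrec₂ X) (hn : Primrec n) (hs : Primrec s) :
    Primrec fun a => Psi (i a) (X a) (n a) (s a) := by
  have hcode : Primrec fun p : α × ℕ => p.2.unpair := Primrec.unpair.comp Primrec.snd
  have hseg : Primrec fun p : α × ℕ => initSeg (X p.1) p.2.unpair.1 :=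
    primrec_initSeg (hX.comp (Primrec.fst.comp Primrec.fst) Primrec.snd) (Primrec.fst.comp hcode)
  exact primrec_findSome? (Primrec.list_range.comp (Primrec.succ.comp hs)) <|
    Nat.Partrec.Code.primrec_evaln.comp <| Primrec.pair
      (Primrec.pair (Primrec.snd.comp hcode) ((Primrec.ofNat _).comp (hi.comp Primrec.fst)))
      (Primrec.encode.comp (Primrec.pair hseg (hn.comp Primrec.fst)))

theorem primrec_rawPhi (hX : Primrec₂ X) (hn : Primrec n) (hs : Primrec s) :
    Primrec fun a => rawPhi (X a) (n a) (s a) := by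
  have odd : Primrec fun j : ℕ => 2 * j + 1 :=
    Primrec.succ.comp (Primrec.nat_mul.comp (Primrec.const 2) Primrec.id)
  have hX' : Primrec₂ fun p : α × ℕ => X p.1 := hX.comp (Primrec.fst.comp Primrec.fst) Primrec.snd
  refine Primrec.option_bind (primrec_find? (Primrec.list_range.comp (Primrec.succ.comp hs))
    (hX.comp Primrec.fst (odd.comp Primrec.snd))) (primrec_Psi (α := α × ℕ)
    Primrec.snd (primrec_join ?_ ?_) (hn.comp Primrec.fst) (hs.comp Primrec.fst))
  · exact hX'.comp Primrec.fst (Primrec.nat_mul.comp (Primrec.const 2) Primrec.snd)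
  · exact hX'.comp Primrec.fst (odd.comp (Primrec.nat_add.comp
      (Primrec.succ.comp (Primrec.snd.comp Primrec.fst)) Primrec.snd))

theorem primrecPred_Phi_isSome (hX : Primrec₂ X) (hn : Primrec n) (hs : Primrec s) :
    PrimrecPred fun a => (Phi (X a) (n a) (s a)).isSome := by
  have hraw : PrimrecRel fun (v : ℕ) (p : ℕ × α) => rawPhi (X p.2) p.1 (s p.2) = some v :=
    Primrec.eq.comp (primrec_rawPhi (hX.comp (Primrec.snd.comp (Primrec.snd.comp Primrec.fst))
      Primrec.snd) (Primrec.fst.comp Primrec.snd) (hs.comp (Primrec.snd.comp Primrec.snd)))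
      (Primrec.option_some.comp Primrec.fst)
  have hbounded : PrimrecRel fun (m : ℕ) (a : α) =>
      ∃ v < s a + 1, rawPhi (X a) m (s a) = some v :=
    primrecPred_exists_lt hraw (Primrec.succ.comp (hs.comp Primrec.snd))
  refine (primrecPred_forall_lt hbounded (Primrec.succ.comp hn)).of_eq fun a => ?_
  simp only [Phi_isSome_iff, Nat.lt_succ_iff]

end Primrec

/-! ### Measures -/

theorem exists_measureReal_lt_of_antitone {α : Type*} [MeasurableSpace α] {μ : Measure α}
    [IsFiniteMeasure μ] {S : ℕ → Set α} (hS : Antitone S) (hm : ∀ n, MeasurableSet (S n))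
    (hI : ⋂ n, S n = ∅) {ε : ℝ} (hε : 0 < ε) : ∃ n, μ.real (S n) < ε := by
  obtain ⟨n, hn⟩ := exists_measure_iInter_lt (fun n => (hm n).nullMeasurableSet)
    (ENNReal.ofReal_pos.2 hε) ⟨0, measure_ne_top μ _⟩ hI
  have hsub : S n ⊆ ⋂ m ≤ n, S m := Set.subset_iInter₂ fun m hm => hS hm
  exact ⟨n, ENNReal.toReal_lt_of_lt_ofReal ((measure_mono hsub).trans_lt hn)⟩

theorem measureReal_sdiff_triangle {α : Type*} [MeasurableSpace α] (μ : Measure α)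
    [IsFiniteMeasure μ] (S T U : Set α) : μ.real (S \ U) ≤ μ.real (S \ T) + μ.real (T \ U) :=
  (measureReal_mono (sdiff_triangle S T U)).trans (measureReal_union_le _ _)

theorem measurable_of_dependsOn {ι β : Type*} {α : ι → Type*} [∀ i, MeasurableSpace (α i)]
    [∀ i, MeasurableSingletonClass (α i)] [∀ i, Finite (α i)] [Nonempty β] [MeasurableSpace β]
    {f : (∀ i, α i) → β} {s : Set ι} (hs : s.Finite) (hf : DependsOn f s) : Measurable f := by
  obtain ⟨g, rfl⟩ := dependsOn_iff_exists_comp.1 hf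
  have := hs.to_subtype
  exact (Measurable.of_discrete (f := g)).comp
    (measurable_pi_lambda _ fun i => measurable_pi_apply _)

/-- The sequence with first entry `a`, continued by `x`. -/
def consSeq {α : Type*} (a : α) (x : ℕ → α) : ℕ → α
  | 0 => a
  | n + 1 => x n

theorem measurable_consSeq {α : Type*} [MeasurableSpace α] :
    Measurable fun p : α × (ℕ → α) => consSeq p.1 p.2 :=
  measurable_pi_lambda _ fun n => match n with
    | 0 => measurable_fst
    | n + 1 => (measurable_pi_apply n).comp measurable_snd

open Classical in
theorem consSeq_preimage_pi {α : Type*} (s : Finset ℕ) (t : ℕ → Set α) :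
    (fun p : α × (ℕ → α) => consSeq p.1 p.2) ⁻¹' Set.pi s t =
      (if 0 ∈ s then t 0 else Set.univ) ×ˢ
        Set.pi (s.preimage Nat.succ Nat.succ_injective.injOn) fun n => t (n + 1) := by
  ext ⟨a, x⟩
  simp only [Set.mem_preimage, Set.mem_pi, Finset.mem_coe, Set.mem_prod, Finset.mem_preimage]
  refine ⟨fun h => ⟨?_, fun n hn => h (n + 1) hn⟩, fun h n hn => ?_⟩
  · split_ifs with h0
    exacts [h 0 h0, Set.mem_univ _]
  · cases n with
    | zero => exact (if_pos hn ▸ h).1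
    | succ n => exact h.2 n hn

theorem prod_eq_mul_prod_preimage_succ {M : Type*} [CommMonoid M] (s : Finset ℕ) (g : ℕ → M) :
    ∏ n ∈ s, g n = (if 0 ∈ s then g 0 else 1) *
      ∏ n ∈ s.preimage Nat.succ Nat.succ_injective.injOn, g (n + 1) := by
  classical
  have hsucc : s.filter (· ∈ Set.range Nat.succ) = s.filter (¬ · = 0) :=
    Finset.filter_congr fun n _ => by rw [Nat.range_succ]; exact Nat.pos_iff_ne_zero
  rw [Finset.prod_preimage' Nat.succ s Nat.succ_injective.injOn g, hsucc,
    ← Finset.prod_filter_mul_prod_filter_not s (· = 0), Finset.filter_eq']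
  split_ifs <;> simp only [Finset.prod_singleton, Finset.prod_empty]

theorem map_consSeq_prod_infinitePi {α : Type*} [MeasurableSpace α] (μ : ℕ → Measure α)
    [∀ n, IsProbabilityMeasure (μ n)] :
    ((μ 0).prod (Measure.infinitePi fun n => μ (n + 1))).map (fun p => consSeq p.1 p.2) =
      Measure.infinitePi μ := by
  classical
  refine Measure.eq_infinitePi _ fun s t ht => ?_
  rw [Measure.map_apply measurable_consSeq
    (MeasurableSet.pi (Finset.countable_toSet s) fun n _ => ht n), consSeq_preimage_pi,
    Measure.prod_prod, Measure.infinitePi_pi _ fun n _ => ht (n + 1),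
    prod_eq_mul_prod_preimage_succ s]
  split_ifs <;> simp only [measure_univ]

theorem ae_consSeq {α : Type*} [Countable α] [MeasurableSpace α]
    {μ : ℕ → Measure α} [∀ n, IsProbabilityMeasure (μ n)] {p : (ℕ → α) → Prop}
    (h : ∀ᵐ x ∂Measure.infinitePi μ, p x) {a : α} (ha : μ 0 {a} ≠ 0) :
    ∀ᵐ x ∂Measure.infinitePi fun n => μ (n + 1), p (consSeq a x) := by
  rw [← map_consSeq_prod_infinitePi] at h
  have hae := Measure.ae_ae_of_ae_prod (ae_of_ae_map measurable_consSeq.aemeasurable h)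
  exact ae_iff_of_countable.1 hae a ha

/-! ### The fair-coin measure -/

theorem coinMeasure_real_cylinder (X : Cantor) (m : ℕ) :
    coinMeasure.real (PiNat.cylinder X m) = 2⁻¹ ^ m := by
  rw [PiNat.cylinder_eq_pi, Measure.real, coinMeasure,
    Measure.infinitePi_pi _ fun _ _ => MeasurableSet.of_discrete]
  simp

theorem setOf_eq_biUnion_cylinder {p : Cantor → Prop} {m : ℕ} (hp : DependsOn p (Set.Iio m))
    [DecidablePred fun t : ℕ => p t.testBit] :
    {X | p X} = ⋃ t ∈ (Finset.range (2 ^ m)).filter fun t => p t.testBit,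
      PiNat.cylinder t.testBit m := by
  ext X
  simp only [Set.mem_iUnion, Finset.mem_filter, Finset.mem_range, Set.mem_ofPred_eq, exists_prop,
    PiNat.mem_cylinder_iff]
  refine ⟨fun hX => ?_, fun ⟨t, ⟨_, ht⟩, hXt⟩ => (hp hXt).mpr ht⟩
  have hbits : ∀ j < m, X j = (Nat.ofBits fun i : Fin m => X i).testBit j := fun j hj =>
    (Nat.testBit_ofBits_lt (fun i : Fin m => X i) j hj).symm
  exact ⟨_, ⟨Nat.ofBits_lt_two_pow _, (hp hbits).mp hX⟩, hbits⟩

theorem pairwiseDisjoint_cylinder_testBit (m : ℕ) :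
    (Set.Iio (2 ^ m)).PairwiseDisjoint fun t : ℕ =>
      PiNat.cylinder (E := fun _ => Bool) t.testBit m := by
  refine fun t ht u hu htu => Set.disjoint_left.2 fun Z hZt hZu =>
    htu (Nat.eq_of_testBit_eq fun j => ?_)
  rcases lt_or_ge j m with hj | hj
  · rw [← hZt j hj, hZu j hj]
  · have hle : 2 ^ m ≤ 2 ^ j := Nat.pow_le_pow_right two_pos hj
    rw [Nat.testBit_lt_two_pow (ht.trans_le hle), Nat.testBit_lt_two_pow (hu.trans_le hle)]

theorem coinMeasure_real_setOf {p : Cantor → Prop} {m : ℕ} (hp : DependsOn p (Set.Iio m))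
    [DecidablePred fun t : ℕ => p t.testBit] :
    coinMeasure.real {X | p X} = Nat.count (fun t => p t.testBit) (2 ^ m) / 2 ^ m := by
  rw [setOf_eq_biUnion_cylinder hp, measureReal_biUnion_finset]
  · simp only [coinMeasure_real_cylinder, Finset.sum_const, nsmul_eq_mul, inv_pow, div_eq_mul_inv,
      Nat.count_eq_card_filter_range]
  · exact (pairwiseDisjoint_cylinder_testBit m).subset fun t ht =>
      Finset.mem_range.1 (Finset.mem_filter.1 ht).1
  · intro t _
    rw [PiNat.cylinder_eq_pi]
    exact MeasurableSet.pi (Finset.countable_toSet _) fun _ _ => MeasurableSet.of_discrete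

/-- The sequence `0^i 1 Z`, by which `Φ` is told to simulate `Ψ_i`. -/
def codeIndex (i : ℕ) (Z : Cantor) : Cantor := (consSeq false)^[i] (consSeq true Z)

theorem codeIndex_succ (i : ℕ) (Z : Cantor) :
    codeIndex (i + 1) Z = consSeq false (codeIndex i Z) :=
  Function.iterate_succ_apply' _ _ _

theorem codeIndex_of_lt {i j : ℕ} (Z : Cantor) (h : j < i) : codeIndex i Z j = false := by
  induction i generalizing j with
  | zero => exact absurd h j.not_lt_zero
  | succ i ih =>
    rw [codeIndex_succ]
    cases j with
    | zero => rfl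
    | succ j => exact ih (Nat.succ_lt_succ_iff.1 h)

theorem codeIndex_self (i : ℕ) (Z : Cantor) : codeIndex i Z i = true := by
  induction i with
  | zero => rfl
  | succ i ih => rw [codeIndex_succ, consSeq, ih]

theorem codeIndex_add (i : ℕ) (Z : Cantor) (j : ℕ) : codeIndex i Z (i + 1 + j) = Z j := by
  induction i with
  | zero => rw [zero_add, add_comm]; rfl
  | succ i ih => rw [codeIndex_succ, Nat.succ_add, consSeq, ih]

theorem ae_codeIndex {p : Cantor → Prop} (h : ∀ᵐ W ∂coinMeasure, p W) (i : ℕ) :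
    ∀ᵐ Z ∂coinMeasure, p (codeIndex i Z) := by
  have hcons : ∀ (b : Bool) {q : Cantor → Prop}, (∀ᵐ W ∂coinMeasure, q W) →
      ∀ᵐ Z ∂coinMeasure, q (consSeq b Z) := fun b _ hq => ae_consSeq hq (by simp)
  induction i generalizing p with
  | zero => exact hcons true h
  | succ i ih => simpa only [codeIndex_succ] using ih (hcons false h)

/-! ### Stages of the domain of the universal functional -/

/-- The set of all `Z` such that `Φ(B ⊕ Z; n)↓[s]`. By the normalization of `Φ` it decreases in
`n` and increases in `s`, and `dom_B Φ = ⋂ n, ⋃ s, stage B n s`. -/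
def stage (B : Cantor) (n s : ℕ) : Set Cantor := {Z | (Phi (join B Z) n s).isSome}

section Stages

variable {B : Cantor}

theorem stage_subset_stage {m n s t : ℕ} (hmn : m ≤ n) (hst : s ≤ t) :
    stage B n s ⊆ stage B m t :=
  fun _ h => Phi_isSome_mono hmn hst h

theorem domPhi_eq_iInter_iUnion_stage (B : Cantor) : domPhi B = ⋂ n, ⋃ s, stage B n s := by
  ext Z
  simp only [domPhi, stage, Set.mem_iInter, Set.mem_iUnion, Set.mem_ofPred_eq]

theorem Phi_join_congr {B' Z Z' : Cantor} {n s : ℕ} (hB : ∀ j < 2 * (s + 1), B j = B' j)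
    (hZ : ∀ j < 2 * (s + 1), Z j = Z' j) : Phi (join B Z) n s = Phi (join B' Z') n s :=
  dependsOn_Phi n s fun j (hj : j < _) => join_congr hB hZ j (by omega)

theorem measurableSet_stage (B : Cantor) (n s : ℕ) : MeasurableSet (stage B n s) := by
  have hdep : DependsOn (fun Z => ((Phi (join B Z) n s).isSome : Prop))
      (Set.Iio (2 * (s + 1))) := fun Z Z' hZ => by
    simp only [Phi_join_congr (fun _ _ => rfl) hZ]
  exact measurableSet_setOfPred.2 (measurable_of_dependsOn (Set.finite_Iio _) hdep)

theorem measurableSet_domPhi (B : Cantor) : MeasurableSet (domPhi B) := by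
  rw [domPhi_eq_iInter_iUnion_stage]
  exact .iInter fun n => .iUnion fun s => measurableSet_stage B n s

theorem exists_measureReal_domPhi_diff_stage_lt (B : Cantor) (n : ℕ) {ε : ℝ} (hε : 0 < ε) :
    ∃ s, coinMeasure.real (domPhi B \ stage B n s) < ε := by
  refine exists_measureReal_lt_of_antitone
    (fun s t hst => Set.sdiff_subset_sdiff_right (stage_subset_stage le_rfl hst))
    (fun s => (measurableSet_domPhi B).diff (measurableSet_stage B n s)) ?_ hε
  rw [← Set.sdiff_iUnion, Set.sdiff_eq_empty, domPhi_eq_iInter_iUnion_stage]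
  exact Set.iInter_subset _ n

theorem exists_measureReal_iUnion_stage_diff_domPhi_lt (B : Cantor) {ε : ℝ} (hε : 0 < ε) :
    ∃ n, coinMeasure.real ((⋃ s, stage B n s) \ domPhi B) < ε := by
  refine exists_measureReal_lt_of_antitone (S := fun n => (⋃ s, stage B n s) \ domPhi B)
    (fun m n hmn => Set.sdiff_subset_sdiff_left
      (Set.iUnion_mono fun s => stage_subset_stage hmn le_rfl))
    (fun n => (MeasurableSet.iUnion fun s => measurableSet_stage B n s).diff
      (measurableSet_domPhi B)) ?_ hε
  simp only [Set.sdiff_eq, ← Set.iInter_inter, ← domPhi_eq_iInter_iUnion_stage,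
    Set.inter_compl_self]

theorem exists_stage_approx_domPhi (B : Cantor) {ε : ℝ} (hε : 0 < ε) :
    ∃ n s, coinMeasure.real (domPhi B \ stage B n s) < ε ∧
      coinMeasure.real (stage B n s \ domPhi B) < ε := by
  obtain ⟨n, hn⟩ := exists_measureReal_iUnion_stage_diff_domPhi_lt B hε
  obtain ⟨s, hs⟩ := exists_measureReal_domPhi_diff_stage_lt B n hε
  have hsub := Set.sdiff_subset_sdiff_left (t := domPhi B) (Set.subset_iUnion (stage B n) s)
  exact ⟨n, s, hs, (measureReal_mono hsub).trans_lt hn⟩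

theorem boundedBy_eq_univ {n : ℕ} {g : List ℕ} (h : g.length ≤ n) : boundedBy B n g = Set.univ :=
  Set.eq_univ_of_forall fun _ _ hk hn => absurd hk (h.trans hn).not_gt

theorem boundedBy_subset_of_prefix {g g' : List ℕ} (n : ℕ) (h : g <+: g') :
    boundedBy B n g' ⊆ boundedBy B n g := fun _ hZ k hk hn => by
  rw [h.getElem hk]
  exact hZ k (hk.trans_le h.length_le) hn

theorem mem_boundedBy_initSeg {f : ℕ → ℕ} {n l : ℕ} {Z : Cantor} :
    Z ∈ boundedBy B n (initSeg f l) ↔ ∀ k < l, n ≤ k → Z ∈ stage B k (f k) := by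
  simp only [boundedBy, initSeg, stage, Set.mem_ofPred_eq, List.length_map, List.length_range,
    List.getElem_map, List.getElem_range]

theorem stage_subset_boundedBy_concat (g : List ℕ) (s : ℕ) :
    stage B g.length s ⊆ boundedBy B g.length (g ++ [s]) := by
  intro Z hZ k hk hle
  obtain rfl : k = g.length := le_antisymm (by simpa [Nat.lt_succ_iff] using hk) hle
  rwa [List.getElem_concat_length rfl]

end Stages

/-! ### Forcing conditions -/

section ForcingNotion

variable {P : Type} [Preorder P]

theorem forSufficientlyGeneric_meets {ι : Type*} [Countable ι] {D : ι → Set P}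
    (hD : ∀ i, ForcingDense (D i)) :
    ForSufficientlyGeneric fun G => ∀ i, ∃ p ∈ D i, p ∈ G :=
  ⟨Set.range D, Set.countable_range D, Set.forall_mem_range.2 hD,
    fun _ hG i => hG _ (Set.mem_range_self i)⟩

theorem ForSufficientlyGeneric.mono {Q R : Order.PFilter P → Prop}
    (hQ : ForSufficientlyGeneric Q) (h : ∀ G, Q G → R G) : ForSufficientlyGeneric R := by
  obtain ⟨𝒟, countable, dense, hG⟩ := hQ
  exact ⟨𝒟, countable, dense, fun G meets => h G (hG G meets)⟩

theorem ForSufficientlyGeneric.and {Q R : Order.PFilter P → Prop}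
    (hQ : ForSufficientlyGeneric Q) (hR : ForSufficientlyGeneric R) :
    ForSufficientlyGeneric fun G => Q G ∧ R G := by
  obtain ⟨𝒟, countable, dense, hG⟩ := hQ
  obtain ⟨ℰ, countable', dense', hG'⟩ := hR
  exact ⟨𝒟 ∪ ℰ, countable.union countable', fun D hD => hD.elim (dense D) (dense' D), fun G meets =>
    ⟨hG G fun D hD => meets D (Or.inl hD), hG' G fun D hD => meets D (Or.inr hD)⟩⟩

end ForcingNotion

section Conditions

variable {B : Cantor} {p q : Condition B}

theorem Condition.mk_stem_le (p : Condition B) {δ : ℚ} (h0 : 0 < δ) (h : δ ≤ p.eps) :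
    (⟨p.stem, δ, h0⟩ : Condition B) ≤ p :=
  ⟨List.prefix_rfl, h, fun hne => absurd rfl hne⟩

theorem Condition.stem_prefix_of_le (h : q ≤ p) : p.stem <+: q.stem := h.1

theorem Condition.measureReal_domPhi_diff_boundedBy_lt (h : q ≤ p) :
    coinMeasure.real (domPhi B \ boundedBy B p.stem.length q.stem) < p.eps := by
  by_cases hstem : p.stem = q.stem
  · rw [← hstem, boundedBy_eq_univ le_rfl, Set.sdiff_univ, measureReal_empty]
    exact Rat.cast_pos.2 p.eps_pos
  · have hq : (0 : ℝ) < q.eps := Rat.cast_pos.2 q.eps_pos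
    linarith [h.2.2 hstem]

theorem Condition.exists_le_length_eq_succ (p : Condition B) :
    ∃ q ≤ p, q.stem.length = p.stem.length + 1 := by
  have hε : (0 : ℝ) < p.eps / 2 := half_pos (Rat.cast_pos.2 p.eps_pos)
  obtain ⟨s, hs⟩ := exists_measureReal_domPhi_diff_stage_lt B p.stem.length hε
  refine ⟨⟨p.stem ++ [s], p.eps / 2, half_pos p.eps_pos⟩,
    ⟨List.prefix_append _ _, (half_lt_self p.eps_pos).le, fun _ => ?_⟩, List.length_append⟩
  have hsub := Set.sdiff_subset_sdiff_right (s := domPhi B)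
    (stage_subset_boundedBy_concat (B := B) p.stem s)
  calc coinMeasure.real (domPhi B \ boundedBy B p.stem.length (p.stem ++ [s])) + (p.eps / 2 : ℚ)
      < p.eps / 2 + (p.eps / 2 : ℚ) := by gcongr; exact (measureReal_mono hsub).trans_lt hs
    _ = p.eps := by push_cast; ring

theorem forcingDense_lt_length_stem (n : ℕ) :
    ForcingDense {q : Condition B | n < q.stem.length} := by
  intro p
  induction n with
  | zero =>
    obtain ⟨q, hqp, hq⟩ := p.exists_le_length_eq_succ
    exact ⟨q, Nat.lt_of_lt_of_eq (Nat.succ_pos _) hq.symm, hqp⟩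
  | succ n ih =>
    obtain ⟨r, hr, hrp⟩ := ih
    obtain ⟨q, hqr, hq⟩ := r.exists_le_length_eq_succ
    exact ⟨q, (Nat.succ_lt_succ hr).trans_eq hq.symm, hqr.trans hrp⟩

theorem forcingDense_eps_le {δ : ℚ} (hδ : 0 < δ) :
    ForcingDense {q : Condition B | q.eps ≤ δ} := fun p =>
  ⟨⟨p.stem, min p.eps δ, lt_min p.eps_pos hδ⟩, min_le_right p.eps δ,
    p.mk_stem_le _ (min_le_left _ _)⟩

end Conditions

/-! ### Generic functions -/

section GenericFunction

variable {B : Cantor} {G : Order.PFilter (Condition B)} {f : ℕ → ℕ} {p : Condition B}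

theorem exists_isGenericFunction (h : ∀ n, ∃ p : Condition B, n < p.stem.length ∧ p ∈ G) :
    ∃ f, IsGenericFunction G f := by
  choose p hp hpG using h
  refine ⟨fun n => (p n).stem[n]'(hp n), fun n m => ⟨?_, ?_⟩⟩
  · rintro rfl
    exact ⟨p n, hpG n, List.getElem?_eq_getElem (hp n)⟩
  · rintro ⟨q, hq, hm⟩
    obtain ⟨hn, rfl⟩ := List.getElem?_eq_some_iff.1 hm
    obtain ⟨r, -, hrp, hrq⟩ := G.directed (p n) (hpG n) q hq
    exact ((Condition.stem_prefix_of_le hrp).getElem _).trans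
      ((Condition.stem_prefix_of_le hrq).getElem hn).symm

theorem forSufficientlyGeneric_exists_isGenericFunction (B : Cantor) :
    ForSufficientlyGeneric fun G : Order.PFilter (Condition B) => ∃ f, IsGenericFunction G f :=
  (forSufficientlyGeneric_meets forcingDense_lt_length_stem).mono fun _ => exists_isGenericFunction

theorem IsGenericFunction.stem_eq_initSeg (hf : IsGenericFunction G f) (hp : p ∈ G) :
    p.stem = initSeg f p.stem.length := by
  refine List.ext_getElem (length_initSeg f _).symm fun n hn _ => ?_
  simp only [initSeg, List.getElem_map, List.getElem_range]
  exact ((hf n _).2 ⟨p, hp, List.getElem?_eq_getElem hn⟩).symm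

theorem IsGenericFunction.exists_le_lt_length (hf : IsGenericFunction G f) (hp : p ∈ G) (n : ℕ) :
    ∃ q ∈ G, q ≤ p ∧ n < q.stem.length := by
  obtain ⟨r, hrG, hr⟩ := (hf n (f n)).1 rfl
  obtain ⟨q, hqG, hqp, hqr⟩ := G.directed p hp r hrG
  exact ⟨q, hqG, hqp, (List.getElem?_eq_some_iff.1 hr).1.trans_le
    (Condition.stem_prefix_of_le hqr).length_le⟩

theorem IsGenericFunction.measure_domPhi_diff_boundedBy_le (hf : IsGenericFunction G f)
    (hp : p ∈ G) (l : ℕ) :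
    coinMeasure (domPhi B \ boundedBy B p.stem.length (initSeg f l)) ≤ ENNReal.ofReal p.eps := by
  obtain ⟨q, hqG, hqp, hlen⟩ := hf.exists_le_lt_length hp l
  have hprefix : initSeg f l <+: q.stem :=
    hf.stem_eq_initSeg hqG ▸ initSeg_prefix_initSeg f hlen.le
  calc coinMeasure (domPhi B \ boundedBy B p.stem.length (initSeg f l))
      ≤ coinMeasure (domPhi B \ boundedBy B p.stem.length q.stem) :=
        measure_mono (Set.sdiff_subset_sdiff_right (boundedBy_subset_of_prefix _ hprefix))
    _ ≤ ENNReal.ofReal p.eps := by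
        rw [← ofReal_measureReal]
        exact ENNReal.ofReal_le_ofReal (Condition.measureReal_domPhi_diff_boundedBy_lt hqp).le

theorem IsGenericFunction.measure_not_eventually_mem_stage_le (hf : IsGenericFunction G f)
    (hp : p ∈ G) :
    coinMeasure {Z | ¬ (Z ∈ domPhi B → ∀ᶠ k in atTop, Z ∈ stage B k (f k))} ≤
      ENNReal.ofReal p.eps := by
  set S : ℕ → Set Cantor := fun l => domPhi B \ boundedBy B p.stem.length (initSeg f l)
  have hmono : Monotone S := fun l l' hl => Set.sdiff_subset_sdiff_right
    (boundedBy_subset_of_prefix _ (initSeg_prefix_initSeg f hl))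
  have hsub : {Z | ¬ (Z ∈ domPhi B → ∀ᶠ k in atTop, Z ∈ stage B k (f k))} ⊆ ⋃ l, S l := by
    intro Z hZ
    obtain ⟨hdom, hZ⟩ := Classical.not_imp.1 hZ
    obtain ⟨k, hk, hZk⟩ := frequently_atTop.1 (not_eventually.1 hZ) p.stem.length
    exact Set.mem_iUnion.2 ⟨k + 1, hdom, fun h =>
      hZk (mem_boundedBy_initSeg.1 h k k.lt_succ_self hk)⟩
  refine (measure_mono hsub).trans (hmono.measure_iUnion.trans_le (iSup_le fun l => ?_))
  exact hf.measure_domPhi_diff_boundedBy_le hp l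

theorem IsGenericFunction.ae_eventually_mem_stage (hf : IsGenericFunction G f)
    (hG : ∀ δ : Set.Ioi (0 : ℚ), ∃ p : Condition B, p.eps ≤ δ ∧ p ∈ G) :
    ∀ᵐ Z ∂coinMeasure, Z ∈ domPhi B → ∀ᶠ k in atTop, Z ∈ stage B k (f k) := by
  by_contra hpos
  obtain ⟨δ, -, hδ, hlt⟩ := ENNReal.lt_iff_exists_rat_btwn.1 (pos_iff_ne_zero.2 hpos)
  have hδ : 0 < δ := Rat.cast_pos.1 (ENNReal.ofReal_pos.1 hδ)
  obtain ⟨p, hpδ, hpG⟩ := hG ⟨δ, hδ⟩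
  refine hlt.not_ge ((hf.measure_not_eventually_mem_stage_le hpG).trans ?_)
  exact ENNReal.ofReal_le_ofReal (Rat.cast_le.2 hpδ)

theorem uniformlyAEDominatingOver_of_ae_eventually_mem_stage
    (h : ∀ᵐ W ∂coinMeasure, W ∈ domPhi B → ∀ᶠ k in atTop, W ∈ stage B k (f k)) :
    UniformlyAEDominatingOver B f := by
  filter_upwards [ae_all_iff.2 (ae_codeIndex h)] with Z hZ g hg
  obtain ⟨i, hi⟩ := hg.exists_Psi
  have hraw : ∀ n, ∃ s, rawPhi (join B (codeIndex i Z)) n s = some (g n) := fun n => by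
    obtain ⟨s, hs⟩ := hi n
    refine ⟨max i s, ?_⟩
    rw [rawPhi_join (fun j => codeIndex_of_lt Z) (codeIndex_self i Z) (le_max_left i s)]
    simpa only [codeIndex_add] using Psi_mono (le_max_right i s) hs
  have hdom : codeIndex i Z ∈ domPhi B :=
    exists_Phi_isSome fun n => (hraw n).imp fun _ hs => ⟨g n, hs⟩
  filter_upwards [hZ i hdom] with k hk
  obtain ⟨s, hs⟩ := hraw k
  exact le_of_Phi_isSome hk hs

theorem forSufficientlyGeneric_uniformlyAEDominatingOver (B : Cantor) :
    ForSufficientlyGeneric fun G : Order.PFilter (Condition B) =>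
      ∃ f, IsGenericFunction G f ∧ UniformlyAEDominatingOver B f := by
  refine ((forSufficientlyGeneric_exists_isGenericFunction B).and (forSufficientlyGeneric_meets
    fun δ : Set.Ioi (0 : ℚ) => forcingDense_eps_le δ.2)).mono fun G ⟨⟨f, hf⟩, hG⟩ => ?_
  exact ⟨f, hf, uniformlyAEDominatingOver_of_ae_eventually_mem_stage
    (hf.ae_eventually_mem_stage hG)⟩

theorem reducible_char_join (X Y : Cantor) : Reducible (char Y) (char (join X Y)) := by
  have oracle : Nat.RecursiveIn {(char (join X Y) : ℕ →. ℕ)} (char (join X Y)) :=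
    .oracle _ (Set.mem_singleton _)
  have odd : Primrec fun n : ℕ => 2 * n + 1 :=
    Primrec.succ.comp (Primrec.nat_mul.comp (Primrec.const 2) Primrec.id)
  refine RecursiveIn.iff_nat.2 ((recursiveIn_comp oracle
    (recursiveIn_of_primrec odd)).of_eq_tot fun n => ?_)
  simp [char, join_two_mul_add_one]

theorem UniformlyAEDominatingOver.uniformlyAEDominating (h : UniformlyAEDominatingOver B f) :
    UniformlyAEDominating f := by
  filter_upwards [h] with Z hZ g hg
  exact hZ g (hg.trans (reducible_char_join B Z))

end GenericFunction

/-! ### Cone avoidance -/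

/-- A length such that the parts of this length of `B` and `Z` decide whether `Z` belongs to
`stage B n₀ s₀` and to `boundedBy B n g`; it is at least the length of `g`. -/
def useBound (s₀ : ℕ) (g : List ℕ) : ℕ := 2 * (s₀ + g.sum + 1) + g.length

section UseBound

variable {B B' Z Z' : Cantor} {n₀ s₀ : ℕ} (n : ℕ) {g : List ℕ}

theorem mem_stage_diff_boundedBy_congr (hB : ∀ j < useBound s₀ g, B j = B' j)
    (hZ : ∀ j < useBound s₀ g, Z j = Z' j) :
    Z ∈ stage B n₀ s₀ \ boundedBy B n g ↔ Z' ∈ stage B' n₀ s₀ \ boundedBy B' n g := by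
  have Phi_eq : ∀ {k s}, s ≤ s₀ + g.sum → Phi (join B Z) k s = Phi (join B' Z') k s := by
    intro k s hs
    have hle : 2 * (s + 1) ≤ useBound s₀ g := by rw [useBound]; omega
    exact Phi_join_congr (fun j hj => hB j (hj.trans_le hle)) fun j hj => hZ j (hj.trans_le hle)
  refine and_congr ?_ (not_congr (forall₃_congr fun k hk _ => ?_))
  · rw [stage, stage, Set.mem_ofPred_eq, Set.mem_ofPred_eq, Phi_eq (Nat.le_add_right _ _)]
  · rw [Phi_eq ((List.single_le_sum (fun _ _ => Nat.zero_le _) _ (List.getElem_mem hk)).trans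
      (Nat.le_add_left _ _))]

theorem stage_diff_boundedBy_congr (hB : ∀ j < useBound s₀ g, B j = B' j) :
    stage B n₀ s₀ \ boundedBy B n g = stage B' n₀ s₀ \ boundedBy B' n g :=
  Set.ext fun _ => mem_stage_diff_boundedBy_congr n hB fun _ _ => rfl

open Classical in
theorem measureReal_stage_diff_boundedBy (B : Cantor) (n₀ s₀ n : ℕ) (g : List ℕ) :
    coinMeasure.real (stage B n₀ s₀ \ boundedBy B n g) =
      Nat.count (fun t => t.testBit ∈ stage B n₀ s₀ \ boundedBy B n g) (2 ^ useBound s₀ g) /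
        2 ^ useBound s₀ g :=
  coinMeasure_real_setOf fun _ _ hZ =>
    propext (mem_stage_diff_boundedBy_congr n (fun _ _ => rfl) hZ)

open Classical in
theorem measureReal_stage_diff_boundedBy_lt_iff (B : Cantor) (n₀ s₀ n : ℕ) (g : List ℕ) {η : ℚ}
    (hη : 0 ≤ η) :
    coinMeasure.real (stage B n₀ s₀ \ boundedBy B n g) < η ↔
      Nat.count (fun t => t.testBit ∈ stage B n₀ s₀ \ boundedBy B n g) (2 ^ useBound s₀ g) *
        η.den < η.num.toNat * 2 ^ useBound s₀ g := by
  have hden : (0 : ℝ) < η.den := Nat.cast_pos.2 η.den_pos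
  have hnum : (η.num : ℝ) = η.num.toNat := by
    exact_mod_cast (Int.toNat_of_nonneg (Rat.num_nonneg.2 hη)).symm
  rw [measureReal_stage_diff_boundedBy, Rat.cast_def, hnum, div_lt_div_iff₀ (by positivity) hden]
  exact_mod_cast Iff.rfl

end UseBound

section Effectivity

variable {α : Type*} [Primcodable α] {X Z : α → Cantor} {g : α → List ℕ}

theorem primrec_useBound (s₀ : ℕ) : Primrec (useBound s₀) :=
  Primrec.nat_add.comp (Primrec.nat_mul.comp (Primrec.const 2) (Primrec.succ.comp
    (Primrec.nat_add.comp (Primrec.const s₀) primrec_list_sum))) Primrec.list_length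

theorem primrecPred_mem_boundedBy (hX : Primrec₂ X) (n : ℕ) (hg : Primrec g) (hZ : Primrec₂ Z) :
    PrimrecPred fun a => Z a ∈ boundedBy (X a) n (g a) := by
  have hjoin : Primrec₂ fun p : ℕ × α => join (X p.2) (Z p.2) :=
    (primrec_join hX hZ).comp (Primrec.snd.comp Primrec.fst) Primrec.snd
  have hPhi : PrimrecRel fun (k : ℕ) (a : α) =>
      k < n ∨ (Phi (join (X a) (Z a)) k ((g a).getD k 0)).isSome :=
    (Primrec.nat_lt.comp Primrec.fst (Primrec.const n)).or (primrecPred_Phi_isSome hjoin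
      Primrec.fst ((Primrec.list_getD 0).comp (hg.comp Primrec.snd) Primrec.fst))
  refine (primrecPred_forall_lt hPhi (Primrec.list_length.comp hg)).of_eq fun a => ?_
  refine forall₂_congr fun k hk => ?_
  rw [List.getD_eq_getElem _ _ hk, ← not_le, ← imp_iff_not_or]

theorem primrecPred_mem_stage_diff_boundedBy (hX : Primrec₂ X) (n₀ s₀ n : ℕ) (hg : Primrec g)
    (hZ : Primrec₂ Z) : PrimrecPred fun a => Z a ∈ stage (X a) n₀ s₀ \ boundedBy (X a) n (g a) :=
  (primrecPred_Phi_isSome (primrec_join hX hZ) (Primrec.const n₀) (Primrec.const s₀)).and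
    (primrecPred_mem_boundedBy hX n hg hZ).not

theorem primrecPred_measureReal_stage_diff_boundedBy_lt (hX : Primrec₂ X) (n₀ s₀ n : ℕ)
    (hg : Primrec g) {η : ℚ} (hη : 0 ≤ η) :
    PrimrecPred fun a => coinMeasure.real (stage (X a) n₀ s₀ \ boundedBy (X a) n (g a)) < η := by
  classical
  have hX' : Primrec₂ fun p : ℕ × α => X p.2 := hX.comp (Primrec.snd.comp Primrec.fst) Primrec.snd
  have htestBit : Primrec₂ fun p : ℕ × α => p.1.testBit :=
    primrec_testBit.comp (Primrec.fst.comp Primrec.fst) Primrec.snd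
  have hmem : PrimrecRel fun (t : ℕ) (a : α) =>
      t.testBit ∈ stage (X a) n₀ s₀ \ boundedBy (X a) n (g a) :=
    primrecPred_mem_stage_diff_boundedBy hX' n₀ s₀ n (hg.comp Primrec.snd) htestBit
  have hpow := primrec_two_pow.comp ((primrec_useBound s₀).comp hg)
  refine (Primrec.nat_lt.comp (Primrec.nat_mul.comp (primrec_count hmem hpow)
    (Primrec.const η.den)) (Primrec.nat_mul.comp (Primrec.const η.num.toNat) hpow)).of_eq
    fun a => (measureReal_stage_diff_boundedBy_lt_iff (X a) n₀ s₀ n (g a) hη).symm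

end Effectivity

/-- The part of `h ⊕ f` that is determined by the initial segment `g` of `f`. -/
def joinSeg (h : ℕ → ℕ) (g : List ℕ) : List ℕ :=
  initSeg (join h fun n => g.getD n 0) (2 * g.length)

theorem joinSeg_congr {h h' : ℕ → ℕ} {g : List ℕ} (hh : ∀ n < g.length, h n = h' n) :
    joinSeg h g = joinSeg h' g :=
  initSeg_congr (join_congr hh fun _ _ => rfl)

theorem joinSeg_initSeg (h f : ℕ → ℕ) (k : ℕ) :
    joinSeg h (initSeg f k) = initSeg (join h f) (2 * k) := by
  rw [joinSeg, length_initSeg]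
  exact initSeg_congr (join_congr (fun _ _ => rfl) fun n hn => getD_initSeg f 0 hn)

theorem primrec_joinSeg {α : Type*} [Primcodable α] {h : α → ℕ → ℕ} {g : α → List ℕ}
    (hh : Primrec₂ h) (hg : Primrec g) : Primrec fun a => joinSeg (h a) (g a) :=
  primrec_initSeg (primrec_join hh ((Primrec.list_getD 0).comp (hg.comp Primrec.fst) Primrec.snd))
    (Primrec.nat_mul.comp (Primrec.const 2) (Primrec.list_length.comp hg))

/-- The set whose characteristic function begins with the string `σ`. -/
def ofCharSeg (σ : List ℕ) : Cantor := fun n => decide (σ.getD n 0 = 1)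

theorem ofCharSeg_initSeg_char (B : Cantor) {k n : ℕ} (hn : n < k) :
    ofCharSeg (initSeg (char B) k) n = B n := by
  rw [ofCharSeg, getD_initSeg _ _ hn, char]
  cases B n <;> rfl

theorem primrec_ofCharSeg : Primrec₂ ofCharSeg :=
  (Primrec.eq.comp (Primrec.list_getD 0) (Primrec.const 1)).decide

theorem TuringFunctional.reducible_of_search {Γ : TuringFunctional} {f h : ℕ → ℕ} {β : Type*}
    [Primcodable β] {τ : List ℕ → β → List ℕ} (hτ : Primrec₂ τ) {Q : List ℕ → β → Prop}
    (hQ : PrimrecRel Q)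
    (sound : ∀ k b, Q (initSeg h k) b → ∀ x, ∀ v ∈ Γ (τ (initSeg h k) b) x, v = f x)
    (complete : ∀ x, ∃ k b, Q (initSeg h k) b ∧ (Γ (τ (initSeg h k) b) x).Dom) :
    Reducible f h := by
  classical
  obtain ⟨c, hc⟩ := Γ.exists_code
  let P (q : List ℕ × ℕ × ℕ) : Option ℕ :=
    (Encodable.decode (α := β × ℕ) q.2.1).bind fun d =>
      if Q q.1 d.1 then
        Nat.Partrec.Code.evaln d.2 c (Encodable.encode (τ q.1 d.1, q.2.2))
      else none
  have hP : Primrec P := by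
    refine Primrec.option_bind (Primrec.decode.comp (Primrec.fst.comp Primrec.snd)) ?_
    have hσ : Primrec fun p : (List ℕ × ℕ × ℕ) × β × ℕ => p.1.1 := Primrec.fst.comp Primrec.fst
    have hb : Primrec fun p : (List ℕ × ℕ × ℕ) × β × ℕ => p.2.1 := Primrec.fst.comp Primrec.snd
    exact Primrec.ite (hQ.comp hσ hb) (Nat.Partrec.Code.primrec_evaln.comp <| Primrec.pair
      (Primrec.pair (Primrec.snd.comp Primrec.snd) (Primrec.const c))
      (Primrec.encode.comp (Primrec.pair (hτ.comp hσ hb)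
        (Primrec.snd.comp (Primrec.snd.comp Primrec.fst))))) (Primrec.const none)
  refine reducible_of_primrec_search hP (fun k w x v hv => ?_) fun x => ?_
  · obtain ⟨⟨b, u⟩, -, hv⟩ := Option.bind_eq_some_iff.1 hv
    obtain ⟨hQb, hv⟩ := Option.ite_none_right_eq_some.1 hv
    have hv := Nat.Partrec.Code.evaln_sound hv
    rw [hc] at hv
    exact sound k b hQb x v hv
  · obtain ⟨k, b, hQb, hdom⟩ := complete x
    obtain ⟨v, hv⟩ := Part.dom_iff_mem.1 hdom
    rw [← hc] at hv
    obtain ⟨u, hu⟩ := Nat.Partrec.Code.evaln_complete.1 hv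
    refine ⟨k, Encodable.encode (b, u), Option.isSome_iff_exists.2 ⟨_, Option.bind_eq_some_iff.2
      ⟨(b, u), Encodable.encodek _, Option.ite_none_right_eq_some.2 ⟨hQb, hu⟩⟩⟩⟩

theorem reducible_of_extensions {A : ℕ → ℕ} {B : Cantor} {Γ : TuringFunctional} {n₀ s₀ : ℕ}
    {f : List ℕ} {η : ℚ} (hη : 0 ≤ η)
    (sound : ∀ g, f <+: g → coinMeasure.real (stage B n₀ s₀ \ boundedBy B f.length g) < η →
      ∀ x, ∀ v ∈ Γ (joinSeg (char B) g) x, v = A x)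
    (complete : ∀ x, ∃ g, f <+: g ∧
      coinMeasure.real (stage B n₀ s₀ \ boundedBy B f.length g) < η ∧
      (Γ (joinSeg (char B) g) x).Dom) :
    Reducible A (char B) := by
  let τ (σ ρ : List ℕ) : List ℕ := joinSeg (fun n => σ.getD n 0) (f ++ ρ)
  let Q (σ ρ : List ℕ) : Prop := useBound s₀ (f ++ ρ) ≤ σ.length ∧ coinMeasure.real
    (stage (ofCharSeg σ) n₀ s₀ \ boundedBy (ofCharSeg σ) f.length (f ++ ρ)) < η
  have happend : Primrec fun p : List ℕ × List ℕ => f ++ p.2 :=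
    Primrec.list_append.comp (Primrec.const f) Primrec.snd
  have hτ : Primrec₂ τ := primrec_joinSeg
    ((Primrec.list_getD 0).comp (Primrec.fst.comp Primrec.fst) Primrec.snd) happend
  have hX : Primrec₂ fun p : List ℕ × List ℕ => ofCharSeg p.1 :=
    primrec_ofCharSeg.comp (Primrec.fst.comp Primrec.fst) Primrec.snd
  have hQ : PrimrecRel Q := (Primrec.nat_le.comp ((primrec_useBound s₀).comp happend)
    (Primrec.list_length.comp Primrec.fst)).and
      (primrecPred_measureReal_stage_diff_boundedBy_lt hX _ _ _ happend hη)
  have hτ_eq : ∀ {k ρ}, useBound s₀ (f ++ ρ) ≤ k →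
      τ (initSeg (char B) k) ρ = joinSeg (char B) (f ++ ρ) := fun hk =>
    joinSeg_congr fun n hn => getD_initSeg _ _ ((hn.trans_le (Nat.le_add_left _ _)).trans_le hk)
  have hQ_iff : ∀ k ρ, Q (initSeg (char B) k) ρ ↔ useBound s₀ (f ++ ρ) ≤ k ∧
      coinMeasure.real (stage B n₀ s₀ \ boundedBy B f.length (f ++ ρ)) < η := fun k ρ => by
    simp only [Q, length_initSeg]
    refine and_congr_right fun hk => ?_
    rw [stage_diff_boundedBy_congr _ fun j hj => ofCharSeg_initSeg_char B (hj.trans_le hk)]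
  refine Γ.reducible_of_search hτ hQ (fun k ρ hρ x v hv => ?_) fun x => ?_
  · obtain ⟨hk, hμ⟩ := (hQ_iff k ρ).1 hρ
    exact sound _ (List.prefix_append f ρ) hμ x v (hτ_eq hk ▸ hv)
  · obtain ⟨_, ⟨ρ, rfl⟩, hμ, hdom⟩ := complete x
    exact ⟨_, ρ, (hQ_iff _ ρ).2 ⟨le_rfl, hμ⟩, (hτ_eq le_rfl).symm ▸ hdom⟩

theorem Condition.mk_le_of_measureReal_lt {B : Cantor} {p : Condition B} {g : List ℕ} {δ : ℚ}
    (hδ : 0 < δ) {a b : ℝ} {S : Set Cantor} (hg : p.stem <+: g)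
    (ha : coinMeasure.real (domPhi B \ S) < a)
    (hb : coinMeasure.real (S \ boundedBy B p.stem.length g) < b) (hab : a + b + δ ≤ p.eps) :
    (⟨g, δ, hδ⟩ : Condition B) ≤ p := by
  have ha0 : 0 ≤ coinMeasure.real (domPhi B \ S) := measureReal_nonneg
  have hb0 : 0 ≤ coinMeasure.real (S \ boundedBy B p.stem.length g) := measureReal_nonneg
  refine ⟨hg, (Rat.cast_le (K := ℝ)).1 (by linarith), fun _ => ?_⟩
  have := measureReal_sdiff_triangle coinMeasure (domPhi B) S (boundedBy B p.stem.length g)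
  linarith

/-- The set of all conditions which force that `Γ` does not compute `A` from `B ⊕ f^G`: either
`Γ` already gives a wrong answer, or `Γ` diverges at some `x` on all extensions. -/
def avoids (A : ℕ → ℕ) (B : Cantor) (Γ : TuringFunctional) : Set (Condition B) :=
  {q | (∃ x, ∃ v ∈ Γ (joinSeg (char B) q.stem) x, v ≠ A x) ∨
    ∃ x, ∀ r ≤ q, ¬ (Γ (joinSeg (char B) r.stem) x).Dom}

theorem forcingDense_avoids {A : ℕ → ℕ} {B : Cantor} (hA : ¬ Reducible A (char B))
    (Γ : TuringFunctional) : ForcingDense (avoids A B Γ) := by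
  intro p
  obtain ⟨η, hη, hηp⟩ : ∃ η : ℚ, 0 < η ∧ 3 * η = p.eps :=
    ⟨p.eps / 3, div_pos p.eps_pos three_pos, mul_div_cancel₀ _ three_ne_zero⟩
  have hηp' : (3 * η : ℝ) = p.eps := by exact_mod_cast hηp
  have hη' : (0 : ℝ) < η := Rat.cast_pos.2 hη
  obtain ⟨n₀, s₀, hdom, hstage⟩ := exists_stage_approx_domPhi B (half_pos hη')
  by_contra! hp
  refine hA (reducible_of_extensions (Γ := Γ) (n₀ := n₀) (s₀ := s₀) (f := p.stem) hη.le
    (fun g hg hμ x v hv => ?_) fun x => ?_)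
  · by_contra hne
    exact hp ⟨g, η, hη⟩ (Or.inl ⟨x, v, hv, hne⟩)
      (Condition.mk_le_of_measureReal_lt hη hg hdom hμ (by linarith))
  · by_contra! hx
    refine hp ⟨p.stem, η / 2, half_pos hη⟩ (Or.inr ⟨x, fun r hr => ?_⟩)
      (p.mk_stem_le _ (by linarith))
    have hprefix := Condition.stem_prefix_of_le hr
    refine hx r.stem hprefix ?_
    have hr' := Condition.measureReal_domPhi_diff_boundedBy_lt hr
    push_cast at hr'
    linarith [measureReal_sdiff_triangle coinMeasure (stage B n₀ s₀) (domPhi B)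
      (boundedBy B p.stem.length r.stem)]

theorem IsGenericFunction.not_reducible {A : ℕ → ℕ} {B : Cantor}
    {G : Order.PFilter (Condition B)} {f : ℕ → ℕ} (hf : IsGenericFunction G f)
    (hG : ∀ Γ, ∃ p ∈ avoids A B Γ, p ∈ G) : ¬ Reducible A (join (char B) f) := by
  intro hred
  obtain ⟨Γ, hΓ⟩ := hred.exists_computes
  obtain ⟨p, ⟨x, v, hv, hne⟩ | ⟨x, hx⟩, hpG⟩ := hG Γ
  · rw [hf.stem_eq_initSeg hpG, joinSeg_initSeg] at hv
    exact hne (hΓ.eq_of_mem hv)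
  · obtain ⟨k, hk⟩ := (hΓ x (A x) (Part.mem_some _)).exists_forall_of_atTop
    obtain ⟨q, hqG, hqp, hlen⟩ := hf.exists_le_lt_length hpG k
    refine hx q hqp (Part.dom_iff_mem.2 ⟨A x, ?_⟩)
    rw [hf.stem_eq_initSeg hqG, joinSeg_initSeg]
    exact hk _ (by omega)

theorem forSufficientlyGeneric_not_reducible {A : ℕ → ℕ} {B : Cantor}
    (hA : ¬ Reducible A (char B)) :
    ForSufficientlyGeneric fun G : Order.PFilter (Condition B) =>
      ∃ f, IsGenericFunction G f ∧ ¬ Reducible A (join (char B) f) :=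
  ((forSufficientlyGeneric_exists_isGenericFunction B).and
    (forSufficientlyGeneric_meets (forcingDense_avoids hA))).mono
      fun _ ⟨⟨f, hf⟩, hG⟩ => ⟨f, hf, hf.not_reducible hG⟩

end AEDom

theorem mainTheorem5_general :
    (∀ B : AEDom.Cantor, AEDom.ForSufficientlyGeneric
      fun G : Order.PFilter (AEDom.Condition B) =>
        ∃ f, AEDom.IsGenericFunction G f ∧ AEDom.UniformlyAEDominatingOver B f) ∧
    (∀ (A : ℕ → ℕ) (B : AEDom.Cantor), ¬ AEDom.Reducible A (AEDom.char B) →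
      AEDom.ForSufficientlyGeneric
        fun G : Order.PFilter (AEDom.Condition B) =>
          ∃ f, AEDom.IsGenericFunction G f ∧
            ¬ AEDom.Reducible A (AEDom.join (AEDom.char B) f)) :=
  ⟨AEDom.forSufficientlyGeneric_uniformlyAEDominatingOver,
    fun _ _ => AEDom.forSufficientlyGeneric_not_reducible⟩

theorem mainTheorem5 :
    -- The unrelativized forcing (`B = ∅`).
    (AEDom.ForSufficientlyGeneric
      fun G : Order.PFilter (AEDom.Condition fun _ => false) =>
        ∃ f, AEDom.IsGenericFunction G f ∧ AEDom.UniformlyAEDominating f) ∧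
    -- The forcing relative to `B`.
    (∀ B : AEDom.Cantor, AEDom.ForSufficientlyGeneric
      fun G : Order.PFilter (AEDom.Condition B) =>
        ∃ f, AEDom.IsGenericFunction G f ∧ AEDom.UniformlyAEDominatingOver B f) ∧
    -- Cone avoidance.
    (∀ A B : AEDom.Cantor, ¬ AEDom.Reducible (AEDom.char A) (AEDom.char B) →
      AEDom.ForSufficientlyGeneric
        fun G : Order.PFilter (AEDom.Condition B) =>
          ∃ f, AEDom.IsGenericFunction G f ∧
            ¬ AEDom.Reducible (AEDom.char A) (AEDom.join (AEDom.char B) f)) := by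
  obtain ⟨dominating, avoiding⟩ := mainTheorem5_general
  refine ⟨(dominating fun _ => false).mono fun _ hG => ?_, dominating, fun A => avoiding _⟩
  exact hG.imp fun _ hf => ⟨hf.1, hf.2.uniformlyAEDominating⟩
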